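/- Let $d,q,k,n\ge 0$ be integers and let $\mathbb P^d_q$ be the space of real polynomials in $d$ variables of total degree less than $q$, viewed as functions on $\mathbb R^d$. Let $K:\mathbb R^d\times\mathbb R^d\to\mathbb R$ be a symmetric kernel that is conditionally positive definite with respect to $\mathbb P^d_q$: for any finite set $\{y_1,\dots,y_N\}\subset\mathbb R^d$ (distinct points) and any $c\in\mathbb R^N\setminus\{0\}$ with $\sum_i c_i p(y_i)=0$ for all $p\in\mathbb P^d_q$, one has $\sum_{i,j}c_ic_jK(y_i,y_j)>0$. Native space. On the finitely supported families $c=(c_y)_{y\in\mathbb R^d}$ with $\sum_y c_y p(y)=0$ for all $p\in\mathbb P^d_q$ consider the inner product $\langle c,c'\rangle=\sum_{y,z}c_yc'_zK(y,z)$, and let $\mathcal H$ be the Hilbert space completion. The native space $F_q(K)$ consists of all $f:\mathbb R^d\to\mathbb R$ for which there is a (necessarily unique) $g_f\in\mathcal H$ with $\sum_y c_yf(y)=\langle g_f,c\rangle$ for all such $c$; its seminorm is $\|f\|_{F_q(K)}=\|g_f\|_{\mathcal H}$. Let $D=\sum_{|\alpha|\le k}a_\alpha\partial^\alpha$ be a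 linear differential operator of order at most $k$ with arbitrary real coefficient functions $a_\alpha$ on $\mathbb R^d$, let $x\in\mathbb R^d$ and $\lambda f=Df(x)$. If $k\ge1$, assume that $K$ has continuous mixed partial derivatives of order up to $k$ in each of its two $d$-dimensional variables on $U\times U$ for some open neighbourhood $U$ of $x$. Let $X=\{x_1,\dots,x_n\}\subset\mathbb R^d$ be a set of $n$ distinct points (not assumed to be determining for $\mathbb P^d_q$). Call $u\in\mathbb R^n$ exact if $Dp(x)=\sum_{i=1}^n u_ip(x_i)$ for all $p\in\mathbb P^d_q$, and put $$E(u)=\sup_{f\in F_q(K),\ \|f\|_{F_q(K)}\le1}\Big|Df(x)-\sum_{i=1}^n u_if(x_i)\Big|\in[0,\infty].$$ Write $D'$ and $D''$ for the application of $f\mapsto Df(x)$ to the first and the second argument of $K$. Then: 1. If $k\ge1$, then every $f\in F_q(K)$, and $K(\cdot,y)$ and $K(y,\cdot)$ for every $y\in\mathbb R^d$, are $C^k$ in a neighbourhood of $x$; so all derivatives below exist. 2. For every exact $u\in\mathbb R^n$, $E(u)$ is finite and $$E^2(u)=D'D''K(x,x)-\sum_{i=1}^n u_i\big(D'K(x,x_i)+D''K(x_i,x)\big)+\sum_{i,j=1}^n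 u_iu_jK(x_i,x_j).$$ 3. If an exact $u\in\mathbb R^n$ exists, then there is a unique $w\in\mathbb R^n$ that is exact and satisfies, for some $\tilde p\in\mathbb P^d_q$, $$\sum_{j=1}^n w_jK(x_i,x_j)+\tilde p(x_i)=D'K(x,x_i),\qquad i=1,\dots,n.$$ 4. Such a $w$ has the optimal recovery property $$E(w)=\min\Big\{E(u):u\in\mathbb R^n,\ Dp(x)=\sum_{i=1}^n u_ip(x_i)\ \text{ for all }p\in\mathbb P^d_q\Big\}.$$ -/

import Mathlib

noncomputable section

namespace OptRec

open Topology ENNReal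

/-! ### Conditionally positive definite kernels and their native spaces -/

/-- A symmetric kernel `K : Ω × Ω → ℝ` that is conditionally positive definite with respect to the
space `P` of functions on `Ω`. -/
structure IsCPDKernel {Ω : Type*} (K : Ω → Ω → ℝ) (P : Submodule ℝ (Ω → ℝ)) : Prop where
  symm : ∀ x y, K x y = K y x
  pos : ∀ (X : Finset Ω) (c : Ω → ℝ), (∃ x ∈ X, c x ≠ 0) →
    (∀ p ∈ P, ∑ x ∈ X, c x * p x = 0) → 0 < ∑ x ∈ X, ∑ y ∈ X, c x * c y * K x y

/-- The action `∑ c_x f(x)` of a finitely supported coefficient family on a function. -/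
def pairing {Ω : Type*} (c : Ω →₀ ℝ) (f : Ω → ℝ) : ℝ := c.sum fun x a => a * f x

/-- The coefficient families `c` with `∑ c_x p(x) = 0` for all `p ∈ P`. -/
def annihilator {Ω : Type*} (P : Submodule ℝ (Ω → ℝ)) : Submodule ℝ (Ω →₀ ℝ) where
  carrier := {c | ∀ p ∈ P, pairing c p = 0}
  zero_mem' := by intro p _; simp [pairing]
  add_mem' := by
    intro c c' hc hc' p hp
    have h1 := hc p hp
    have h2 := hc' p hp
    simp only [pairing] at h1 h2 ⊢
    rw [Finsupp.sum_add_index' (by simp) (by intros; ring), h1, h2, add_zero]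
  smul_mem' := by
    intro r c hc p hp
    have h1 := hc p hp
    simp only [pairing] at h1 ⊢
    rw [Finsupp.sum_smul_index' (by simp)]
    simp only [smul_eq_mul, mul_assoc]
    rw [← Finsupp.mul_sum, h1, mul_zero]

/-- The pre-Hilbert space attached to `K`: the coefficient families annihilating `P` (equivalently,
the functions `∑ c_x K(·, x)`), with inner product `⟨c, c'⟩ = ∑ c_x c'_y K(x, y)`. -/
def PreNative {Ω : Type*} (K : Ω → Ω → ℝ) (P : Submodule ℝ (Ω → ℝ)) (_h : IsCPDKernel K P) :
    Type _ := annihilator P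

section PreNative

variable {Ω : Type*} {K : Ω → Ω → ℝ} {P : Submodule ℝ (Ω → ℝ)} (h : IsCPDKernel K P)

instance : AddCommGroup (PreNative K P h) := inferInstanceAs (AddCommGroup (annihilator P))

instance : Module ℝ (PreNative K P h) := inferInstanceAs (Module ℝ (annihilator P))

/-- The underlying coefficient family. -/
def PreNative.coeff (c : PreNative K P h) : Ω →₀ ℝ := Subtype.val c

/-- The bilinear form `∑ c_x c'_y K(x, y)`. -/
def kernelForm (K : Ω → Ω → ℝ) (c c' : Ω →₀ ℝ) : ℝ :=
  c.sum fun x a => c'.sum fun y b => a * b * K x y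

theorem kernelForm_self_pos (c : PreNative K P h) (hc : c ≠ 0) :
    0 < kernelForm K (c.coeff h) (c.coeff h) := by
  have hc' : c.coeff h ≠ 0 := fun h0 => hc (Subtype.ext h0)
  obtain ⟨x, hx⟩ := Finsupp.support_nonempty_iff.2 hc'
  exact h.pos (c.coeff h).support (c.coeff h) ⟨x, hx, Finsupp.mem_support_iff.1 hx⟩ c.2

/-- The inner product axioms for `kernelForm`. -/
@[reducible]
def preNativeCore : InnerProductSpace.Core ℝ (PreNative K P h) where
  inner c c' := kernelForm K (c.coeff h) (c'.coeff h)
  conj_inner_symm c c' := by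
    simp only [kernelForm, Finsupp.sum, conj_trivial]
    rw [Finset.sum_comm]
    refine Finset.sum_congr rfl fun x _ => Finset.sum_congr rfl fun y _ => ?_
    rw [h.symm]; ring
  re_inner_nonneg c := by
    by_cases hc : c = 0
    · subst hc
      have : PreNative.coeff h 0 = 0 := rfl
      simp [kernelForm, this]
    · exact (kernelForm_self_pos h c hc).le
  add_left c c' e := by
    have : (c + c').coeff h = c.coeff h + c'.coeff h := rfl
    simp only [kernelForm, this]
    rw [Finsupp.sum_add_index' (by simp)]
    intro x a b
    rw [← Finsupp.sum_add]
    congr 1; ext y t; ring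
  smul_left c e r := by
    have : (r • c).coeff h = r • c.coeff h := rfl
    simp only [kernelForm, this, conj_trivial]
    rw [Finsupp.sum_smul_index' (by simp), Finsupp.mul_sum]
    congr 1; ext x a
    rw [Finsupp.mul_sum]
    congr 1; ext y b
    simp only [smul_eq_mul]; ring
  definite c hc := by
    by_contra hne
    exact (kernelForm_self_pos h c hne).ne' hc

instance : NormedAddCommGroup (PreNative K P h) := (preNativeCore h).toNormedAddCommGroup

instance : InnerProductSpace ℝ (PreNative K P h) := InnerProductSpace.ofCore (preNativeCore h).1

/-- The Hilbert space completion of the pre-Hilbert space attached to `K`. -/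
abbrev NativeHilbert : Type _ := UniformSpace.Completion (PreNative K P h)

/-- The element `g` of the completion represents the function `f` if `∑ c_x f(x) = ⟨g, c⟩` for all
`c` annihilating `P`. If `Ξ` is a unisolvent set for `P` and `Π f ∈ P` interpolates `f` on `Ξ`, this
says that `f(x) - Π f(x) = ⟨g, δ_x - ∑_{ξ ∈ Ξ} p_ξ(x) δ_ξ⟩` for all `x`, where the `p_ξ` are the
Lagrange functions in `P`. -/
def Represents (g : NativeHilbert h) (f : Ω → ℝ) : Prop :=
  ∀ c : PreNative K P h, pairing (c.coeff h) f = inner ℝ g (c : NativeHilbert h)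

theorem Represents.unique {g g' : NativeHilbert h} {f : Ω → ℝ} (hg : Represents h g f)
    (hg' : Represents h g' f) : g = g' := by
  refine ext_inner_right ℝ fun v => ?_
  induction v using UniformSpace.Completion.induction_on with
  | hp => exact isClosed_eq (by fun_prop) (by fun_prop)
  | ih c => rw [← hg c, ← hg' c]

theorem pairing_add (c : Ω →₀ ℝ) (f f' : Ω → ℝ) :
    pairing c (f + f') = pairing c f + pairing c f' := by
  simp [pairing, Finsupp.sum, mul_add, Finset.sum_add_distrib]

theorem pairing_smul (c : Ω →₀ ℝ) (r : ℝ) (f : Ω → ℝ) :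
    pairing c (r • f) = r * pairing c f := by
  simp only [pairing, Finsupp.sum, Pi.smul_apply, smul_eq_mul, Finset.mul_sum]
  exact Finset.sum_congr rfl fun x _ => by ring

/-- The native semi-Hilbert space `F(K, P)` of functions on `Ω`; its null space is `P` when
`P` is finite dimensional. -/
def nativeSpace : Submodule ℝ (Ω → ℝ) where
  carrier := {f | ∃ g : NativeHilbert h, Represents h g f}
  zero_mem' := ⟨0, fun c => by simp [pairing]⟩
  add_mem' := by
    rintro f f' ⟨g, hg⟩ ⟨g', hg'⟩
    exact ⟨g + g', fun c => by rw [pairing_add, hg c, hg' c, inner_add_left]⟩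
  smul_mem' := by
    rintro r f ⟨g, hg⟩
    exact ⟨r • g, fun c => by rw [pairing_smul, hg c, real_inner_smul_left]⟩

/-- The unique element of the Hilbert space representing a function of the native space. -/
def nativeRep (f : nativeSpace h) : NativeHilbert h := Classical.choose f.2

/-- The seminorm of the native space. -/
def nativeSeminorm (f : nativeSpace h) : ℝ := ‖nativeRep h f‖

end PreNative

/-- The worst case error of the formula `lam f ≈ ∑ u_i f(x_i)` on the unit ball of the native space,
a supremum in `[0, ∞]`. -/
def worstCaseError {Ω : Type*} {K : Ω → Ω → ℝ} {P : Submodule ℝ (Ω → ℝ)} (h : IsCPDKernel K P)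
    (lam : (Ω → ℝ) → ℝ) {n : ℕ} (X : Fin n → Ω) (u : Fin n → ℝ) : ℝ≥0∞ :=
  ⨆ (f : nativeSpace h) (_ : nativeSeminorm h f ≤ 1),
    ENNReal.ofReal |lam f.1 - ∑ i, u i * f.1 (X i)|

/-- Exactness of the formula `lam f ≈ ∑ u_i f(x_i)` on `P`. -/
def IsExact {Ω : Type*} (P : Submodule ℝ (Ω → ℝ)) (lam : (Ω → ℝ) → ℝ) {n : ℕ} (X : Fin n → Ω)
    (u : Fin n → ℝ) : Prop :=
  ∀ p ∈ P, ∑ i, u i * p (X i) = lam p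

/-- The conditions defining the kernel-based weights `w`:
`∑_j w_j K(x_i, x_j) + p(x_i) = (lam' K)(x_i)` for some `p ∈ P`, where `lam'` acts on the first
argument of `K`, together with exactness on `P`. -/
def IsKernelWeights {Ω : Type*} (K : Ω → Ω → ℝ) (P : Submodule ℝ (Ω → ℝ)) (lam : (Ω → ℝ) → ℝ)
    {n : ℕ} (X : Fin n → Ω) (w : Fin n → ℝ) : Prop :=
  (∃ p ∈ P, ∀ i, ∑ j, w j * K (X i) (X j) + p (X i) = lam fun y => K y (X i)) ∧
    IsExact P lam X w

/-! ### Polynomials and differential operators on `ℝ^d` -/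

/-- The polynomials of order at most `q`, that is of total degree less than `q`, as functions. -/
def polySpace (d q : ℕ) : Submodule ℝ (EuclideanSpace ℝ (Fin d) → ℝ) :=
  Submodule.span ℝ {p | ∃ α : Fin d → ℕ, ∑ i, α i < q ∧ p = fun x => ∏ i, x i ^ α i}

/-- The partial derivative with respect to the `i`-th coordinate. -/
def partialDeriv {d : ℕ} (i : Fin d) (f : EuclideanSpace ℝ (Fin d) → ℝ) :
    EuclideanSpace ℝ (Fin d) → ℝ :=
  fun y => lineDeriv ℝ f y (EuclideanSpace.single i 1)

/-- The partial derivative `∂^α = ∂_1^{α_1} ⋯ ∂_d^{α_d}`. -/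
def multiDeriv {d : ℕ} (α : Fin d → ℕ) (f : EuclideanSpace ℝ (Fin d) → ℝ) :
    EuclideanSpace ℝ (Fin d) → ℝ :=
  (List.finRange d).foldr (fun i g => (partialDeriv i)^[α i] g) f

/-- The multi-indices `α` with `|α| ≤ k`. -/
def multiIndices (d k : ℕ) : Finset (Fin d → ℕ) :=
  (Fintype.piFinset fun _ => Finset.range (k + 1)).filter fun α => ∑ i, α i ≤ k

/-- The linear differential operator `D f = ∑_{|α| ≤ k} a_α ∂^α f` with coefficient functions
`a_α`. -/
def diffOp {d : ℕ} (k : ℕ) (a : (Fin d → ℕ) → EuclideanSpace ℝ (Fin d) → ℝ)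
    (f : EuclideanSpace ℝ (Fin d) → ℝ) : EuclideanSpace ℝ (Fin d) → ℝ :=
  fun y => ∑ α ∈ multiIndices d k, a α y * multiDeriv α f y

/-- The kernel `K` has continuous mixed partial derivatives up to the order `k` in each of its two
`d`-dimensional variables in a neighbourhood `U × U` of `(x, x)`. -/
def HasMixedPartialsNear {d : ℕ} (k : ℕ)
    (K : EuclideanSpace ℝ (Fin d) → EuclideanSpace ℝ (Fin d) → ℝ)
    (x : EuclideanSpace ℝ (Fin d)) : Prop :=
  ∃ U : Set (EuclideanSpace ℝ (Fin d)), IsOpen U ∧ x ∈ U ∧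
    (∀ y ∈ U, ContDiffOn ℝ k (fun z => K y z) U) ∧
    (∀ β ∈ multiIndices d k, ∀ z ∈ U,
      ContDiffOn ℝ k (fun y => multiDeriv β (fun z' => K y z') z) U) ∧
    (∀ α ∈ multiIndices d k, ∀ β ∈ multiIndices d k,
      ContinuousOn (fun yz : EuclideanSpace ℝ (Fin d) × EuclideanSpace ℝ (Fin d) =>
        multiDeriv α (fun y => multiDeriv β (fun z => K y z) yz.2) yz.1) (U ×ˢ U))

end OptRec

end

noncomputable section

namespace OptRec

open Topology ENNReal

/-! ### Iterated partial derivatives along words -/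

/-! For an exact `u` the error functional `f ↦ Df(x) - ∑ u_i f(x_i)` kills `P`, so it depends only
on the element `g` representing `f`. Once it is bounded in `g`, Riesz gives a vector `v` with error
`⟨v, g⟩` (`exists_errorVec`), and everything else is Hilbert space geometry. The worst case error is
`‖v‖`. The vector `v` represents the error functional applied to one argument of `K`, so applying
that functional again yields `‖v‖²` and the quadratic formula. Changing `u` among exact formulas
moves `v` within a translate of the finite-dimensional space of annihilating functionals on the
nodes. The kernel system says precisely that `v` is orthogonal to this space
(`isKernelWeights_iff`). Hence orthogonal projection gives existence, definiteness with distinct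
nodes gives uniqueness, and Pythagoras gives optimality.

The analytic content is the boundedness of `g ↦ Df(x)`, together with the smoothness of native
functions. Finitely many points `Ξ` near `x` reproduce the polynomials through functions `ℓ_ξ`. With
`Φ(z) = δ_z - ∑ ℓ_ξ(z) δ_ξ`, every native function is `⟨g, Φ(·)⟩` plus a polynomial. The squared
norm of an iterated difference of `Φ` is the same difference taken in both arguments of `⟨Φ(y),
Φ(z)⟩`, which is `K(y, z)` up to sums of products of one-variable smooth functions. Bounded mixed
partials of `K` therefore bound the difference quotients of `Φ` (`stepBounded₂_of_mixedPartials`).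
So the derivatives of `⟨g, Φ(·)⟩` are at most `C ‖g‖` whenever they exist. Smoothness is evident for
`g` in the span of nearby `Φ(z)` and passes to limits by uniform convergence of derivatives
(`contDiffOn_inner_of_stepDiff_le`). -/

/-- The iterated partial derivative along a word of coordinates, the head being applied first. -/
def wordDeriv {d : ℕ} : List (Fin d) → (EuclideanSpace ℝ (Fin d) → ℝ) →
    EuclideanSpace ℝ (Fin d) → ℝ
  | [], f => f
  | i :: w, f => wordDeriv w (partialDeriv i f)

section WordDeriv

variable {d : ℕ} {U : Set (EuclideanSpace ℝ (Fin d))}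

theorem partialDeriv_eq_fderiv {f : EuclideanSpace ℝ (Fin d) → ℝ} {y : EuclideanSpace ℝ (Fin d)}
    (hf : DifferentiableAt ℝ f y) (i : Fin d) :
    partialDeriv i f y = fderiv ℝ f y (EuclideanSpace.single i 1) :=
  hf.lineDeriv_eq_fderiv

theorem partialDeriv_congr (hU : IsOpen U) {f g : EuclideanSpace ℝ (Fin d) → ℝ}
    (hfg : Set.EqOn f g U) (i : Fin d) : Set.EqOn (partialDeriv i f) (partialDeriv i g) U := by
  intro y hy
  exact Filter.EventuallyEq.lineDeriv_eq (hfg.eventuallyEq_of_mem (hU.mem_nhds hy))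

theorem contDiffOn_partialDeriv (hU : IsOpen U) {m : ℕ} {f : EuclideanSpace ℝ (Fin d) → ℝ}
    (hf : ContDiffOn ℝ (m + 1 : ℕ) f U) (i : Fin d) : ContDiffOn ℝ m (partialDeriv i f) U := by
  have h1 : ContDiffOn ℝ m (fun y => fderiv ℝ f y (EuclideanSpace.single i 1)) U :=
    (hf.fderiv_of_isOpen hU (by push_cast; rfl)).clm_apply contDiffOn_const
  refine h1.congr fun y hy => partialDeriv_eq_fderiv ?_ i
  exact (hf.differentiableOn (by simp)).differentiableAt (hU.mem_nhds hy)

theorem wordDeriv_congr (hU : IsOpen U) (w : List (Fin d)) {f g : EuclideanSpace ℝ (Fin d) → ℝ}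
    (hfg : Set.EqOn f g U) : Set.EqOn (wordDeriv w f) (wordDeriv w g) U := by
  induction w generalizing f g with
  | nil => exact hfg
  | cons i w ih => exact ih (partialDeriv_congr hU hfg i)

theorem contDiffOn_wordDeriv (hU : IsOpen U) {m : ℕ} (w : List (Fin d))
    {f : EuclideanSpace ℝ (Fin d) → ℝ} (hf : ContDiffOn ℝ (m + w.length : ℕ) f U) :
    ContDiffOn ℝ m (wordDeriv w f) U := by
  induction w generalizing f with
  | nil => exact hf
  | cons i w ih => exact ih (contDiffOn_partialDeriv hU hf i)

theorem continuousOn_wordDeriv (hU : IsOpen U) (w : List (Fin d))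
    {f : EuclideanSpace ℝ (Fin d) → ℝ} (hf : ContDiffOn ℝ w.length f U) :
    ContinuousOn (wordDeriv w f) U :=
  (contDiffOn_wordDeriv (m := 0) hU w (by simpa using hf)).continuousOn

theorem wordDeriv_append (w w' : List (Fin d)) (f : EuclideanSpace ℝ (Fin d) → ℝ) :
    wordDeriv (w ++ w') f = wordDeriv w' (wordDeriv w f) := by
  induction w generalizing f with
  | nil => rfl
  | cons i w ih => exact ih _

theorem differentiableAt_of_contDiffOn_succ (hU : IsOpen U) {m : ℕ}
    {f : EuclideanSpace ℝ (Fin d) → ℝ} (hf : ContDiffOn ℝ (m + 1 : ℕ) f U)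
    {y : EuclideanSpace ℝ (Fin d)} (hy : y ∈ U) : DifferentiableAt ℝ f y :=
  (hf.differentiableOn (by simp)).differentiableAt (hU.mem_nhds hy)

theorem wordDeriv_add (hU : IsOpen U) (w : List (Fin d)) {f g : EuclideanSpace ℝ (Fin d) → ℝ}
    (hf : ContDiffOn ℝ w.length f U) (hg : ContDiffOn ℝ w.length g U) :
    Set.EqOn (wordDeriv w (f + g)) (wordDeriv w f + wordDeriv w g) U := by
  induction w generalizing f g with
  | nil => exact fun _ _ => rfl
  | cons i w ih =>
    have h1 : Set.EqOn (partialDeriv i (f + g)) (partialDeriv i f + partialDeriv i g) U := by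
      intro y hy
      have hf' := differentiableAt_of_contDiffOn_succ hU hf hy
      have hg' := differentiableAt_of_contDiffOn_succ hU hg hy
      rw [Pi.add_apply, partialDeriv_eq_fderiv hf', partialDeriv_eq_fderiv hg',
        partialDeriv_eq_fderiv (hf'.add hg'), fderiv_add hf' hg']
      rfl
    exact (wordDeriv_congr hU w h1).trans
      (ih (contDiffOn_partialDeriv hU hf i) (contDiffOn_partialDeriv hU hg i))

theorem wordDeriv_smul (hU : IsOpen U) (w : List (Fin d)) {f : EuclideanSpace ℝ (Fin d) → ℝ}
    (r : ℝ) (hf : ContDiffOn ℝ w.length f U) :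
    Set.EqOn (wordDeriv w (r • f)) (r • wordDeriv w f) U := by
  induction w generalizing f with
  | nil => exact fun _ _ => rfl
  | cons i w ih =>
    have h1 : Set.EqOn (partialDeriv i (r • f)) (r • partialDeriv i f) U := by
      intro y hy
      have hf' := differentiableAt_of_contDiffOn_succ hU hf hy
      rw [Pi.smul_apply, partialDeriv_eq_fderiv hf', partialDeriv_eq_fderiv (hf'.const_smul r),
        fderiv_const_smul hf' r]
      rfl
    exact (wordDeriv_congr hU w h1).trans (ih (contDiffOn_partialDeriv hU hf i))

theorem wordDeriv_sub (hU : IsOpen U) (w : List (Fin d)) {f g : EuclideanSpace ℝ (Fin d) → ℝ}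
    (hf : ContDiffOn ℝ w.length f U) (hg : ContDiffOn ℝ w.length g U) :
    Set.EqOn (wordDeriv w (f - g)) (wordDeriv w f - wordDeriv w g) U := by
  intro y hy
  have h1 : f - g = f + (-1 : ℝ) • g := by simp [sub_eq_add_neg]
  have hg' : ContDiffOn ℝ w.length ((-1 : ℝ) • g) U := hg.const_smul (-1 : ℝ)
  rw [h1, wordDeriv_add hU w hf hg' hy, Pi.add_apply, wordDeriv_smul hU w (-1) hg hy]
  simp [sub_eq_add_neg]

theorem partialDeriv_comm (hU : IsOpen U) {f : EuclideanSpace ℝ (Fin d) → ℝ}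
    (hf : ContDiffOn ℝ 2 f U) (i j : Fin d) :
    Set.EqOn (partialDeriv i (partialDeriv j f)) (partialDeriv j (partialDeriv i f)) U := by
  have key : ∀ i j : Fin d, ∀ y ∈ U, partialDeriv i (partialDeriv j f) y =
      fderiv ℝ (fderiv ℝ f) y (EuclideanSpace.single i 1) (EuclideanSpace.single j 1) := by
    intro i j y hy
    have h1 : Set.EqOn (partialDeriv j f) (fun y => fderiv ℝ f y (EuclideanSpace.single j 1)) U :=
      fun z hz => partialDeriv_eq_fderiv (differentiableAt_of_contDiffOn_succ (m := 1) hU hf hz) j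
    have h2 : DifferentiableAt ℝ (fderiv ℝ f) y :=
      ((hf.fderiv_of_isOpen hU (m := 1) (by norm_num)).differentiableOn
        (by simp)).differentiableAt (hU.mem_nhds hy)
    rw [partialDeriv_congr hU h1 i hy, partialDeriv_eq_fderiv (h2.clm_apply (by fun_prop)),
      fderiv_clm_apply h2 (by fun_prop)]
    simp
  intro y hy
  rw [key i j y hy, key j i y hy]
  exact ((hf.contDiffAt (hU.mem_nhds hy)).isSymmSndFDerivAt (by simp)).eq _ _

theorem wordDeriv_perm (hU : IsOpen U) {w w' : List (Fin d)} (hw : w.Perm w')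
    {f : EuclideanSpace ℝ (Fin d) → ℝ} (hf : ContDiffOn ℝ w.length f U) :
    Set.EqOn (wordDeriv w f) (wordDeriv w' f) U := by
  induction hw generalizing f with
  | nil => exact fun _ _ => rfl
  | cons i _ ih => exact ih (contDiffOn_partialDeriv hU hf i)
  | swap i j l =>
    refine wordDeriv_congr hU l (partialDeriv_comm hU (hf.of_le ?_) i j)
    simp only [List.length_cons]
    exact_mod_cast (by omega : 2 ≤ l.length + 1 + 1)
  | trans h1 _ ih1 ih2 => exact (ih1 hf).trans (ih2 (h1.length_eq ▸ hf))

/-- The list is reversed because `foldr` applies the operator of the last entry first, while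
`wordDeriv` applies the head first. -/
theorem foldr_partialDeriv_eq_wordDeriv (α : Fin d → ℕ) (l : List (Fin d))
    (f : EuclideanSpace ℝ (Fin d) → ℝ) :
    l.foldr (fun i g => (partialDeriv i)^[α i] g) f =
      wordDeriv (l.reverse.flatMap fun i => List.replicate (α i) i) f := by
  have h : ∀ (i : Fin d) (m : ℕ) (g : EuclideanSpace ℝ (Fin d) → ℝ),
      (partialDeriv i)^[m] g = wordDeriv (List.replicate m i) g := by
    intro i m
    induction m with
    | zero => intro g; rfl
    | succ m ih => intro g; exact ih _
  induction l with
  | nil => rfl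
  | cons i l ih =>
    rw [List.foldr_cons, ih, h, List.reverse_cons, List.flatMap_append, wordDeriv_append]
    simp

/-- The word attached to a multi-index. -/
def multiWord (α : Fin d → ℕ) : List (Fin d) :=
  (List.finRange d).reverse.flatMap fun i => List.replicate (α i) i

theorem multiDeriv_eq_wordDeriv (α : Fin d → ℕ) (f : EuclideanSpace ℝ (Fin d) → ℝ) :
    multiDeriv α f = wordDeriv (multiWord α) f :=
  foldr_partialDeriv_eq_wordDeriv α _ f

theorem count_multiWord (α : Fin d → ℕ) (i : Fin d) : (multiWord α).count i = α i := by
  rw [multiWord, List.count_flatMap, List.map_reverse, List.sum_reverse, ← List.ofFn_eq_map,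
    List.sum_ofFn]
  simp [List.count_replicate]

theorem sum_count_eq_length (w : List (Fin d)) : ∑ i, w.count i = w.length := by
  have := Multiset.sum_count_eq_card (s := Finset.univ) (m := (w : Multiset (Fin d))) (by simp)
  simpa using this

theorem length_multiWord (α : Fin d → ℕ) : (multiWord α).length = ∑ i, α i := by
  rw [← sum_count_eq_length]
  simp only [count_multiWord]

theorem length_multiWord_le {k : ℕ} {α : Fin d → ℕ} (hα : α ∈ multiIndices d k) :
    (multiWord α).length ≤ k := by
  rw [length_multiWord]
  exact (Finset.mem_filter.1 hα).2

theorem count_mem_multiIndices {k : ℕ} {w : List (Fin d)} (hw : w.length ≤ k) :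
    (fun i => w.count i) ∈ multiIndices d k := by
  refine Finset.mem_filter.2 ⟨Fintype.mem_piFinset.2 fun i => Finset.mem_range.2 ?_, ?_⟩
  · have := List.count_le_length (a := i) (l := w)
    omega
  · rwa [sum_count_eq_length]

/-- By symmetry of derivatives only the letter counts matter. This lets inductions run over words
although the hypotheses on `K` are phrased with multi-indices. -/
theorem wordDeriv_eq_multiDeriv (hU : IsOpen U) (w : List (Fin d))
    {f : EuclideanSpace ℝ (Fin d) → ℝ} (hf : ContDiffOn ℝ w.length f U) :
    Set.EqOn (wordDeriv w f) (multiDeriv (fun i => w.count i) f) U := by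
  rw [multiDeriv_eq_wordDeriv]
  refine wordDeriv_perm hU (List.perm_iff_count.2 fun i => ?_) hf
  rw [count_multiWord]

end WordDeriv

/-! ### Iterated differences -/

/-- The iterated difference of `f` with the steps `h e_i`, `(i, h) ∈ L`. -/
def stepDiff {d : ℕ} {M : Type*} [AddCommGroup M] : List (Fin d × ℝ) →
    (EuclideanSpace ℝ (Fin d) → M) → EuclideanSpace ℝ (Fin d) → M
  | [], f, y => f y
  | s :: L, f, y => stepDiff L f (y + s.2 • EuclideanSpace.single s.1 1) - stepDiff L f y

/-- The sum of the step widths. -/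
def totalStep {d : ℕ} (L : List (Fin d × ℝ)) : ℝ := (L.map fun s => |s.2|).sum

/-- The product of the step widths. -/
def prodStep {d : ℕ} (L : List (Fin d × ℝ)) : ℝ := (L.map fun s => |s.2|).prod

section StepDiff

variable {d : ℕ} {M N : Type*} [AddCommGroup M] [AddCommGroup N]

theorem totalStep_cons (s : Fin d × ℝ) (L : List (Fin d × ℝ)) :
    totalStep (s :: L) = |s.2| + totalStep L := by simp [totalStep]

theorem prodStep_cons (s : Fin d × ℝ) (L : List (Fin d × ℝ)) :
    prodStep (s :: L) = |s.2| * prodStep L := by simp [prodStep]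

theorem prodStep_nonneg (L : List (Fin d × ℝ)) : 0 ≤ prodStep L := by
  induction L with
  | nil => simp [prodStep]
  | cons s L ih => rw [prodStep_cons]; positivity

theorem dist_add_step (y : EuclideanSpace ℝ (Fin d)) (i : Fin d) (t : ℝ) :
    dist (y + t • EuclideanSpace.single i 1) y = |t| := by
  simp [dist_eq_norm, norm_smul]

/-- Applied to `A = ⟨g, ·⟩`, this transfers difference estimates between the vector-valued map `Φ`
and the scalar functions `⟨g, Φ(·)⟩`. -/
theorem map_stepDiff (A : M →+ N) (L : List (Fin d × ℝ)) (f : EuclideanSpace ℝ (Fin d) → M)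
    (y : EuclideanSpace ℝ (Fin d)) : A (stepDiff L f y) = stepDiff L (fun z => A (f z)) y := by
  induction L generalizing y with
  | nil => rfl
  | cons s L ih => simp only [stepDiff, map_sub, ih]

theorem stepDiff_sub (L : List (Fin d × ℝ)) (f g : EuclideanSpace ℝ (Fin d) → M)
    (y : EuclideanSpace ℝ (Fin d)) :
    stepDiff L (fun z => f z - g z) y = stepDiff L f y - stepDiff L g y := by
  induction L generalizing y with
  | nil => rfl
  | cons s L ih => simp only [stepDiff, ih]; abel

theorem stepDiff_sum {ι : Type*} (t : Finset ι) (L : List (Fin d × ℝ))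
    (f : ι → EuclideanSpace ℝ (Fin d) → M) (y : EuclideanSpace ℝ (Fin d)) :
    stepDiff L (fun z => ∑ i ∈ t, f i z) y = ∑ i ∈ t, stepDiff L (f i) y := by
  induction L generalizing y with
  | nil => rfl
  | cons s L ih => simp only [stepDiff, ih, Finset.sum_sub_distrib]

theorem stepDiff_comm (L L' : List (Fin d × ℝ))
    (f : EuclideanSpace ℝ (Fin d) → EuclideanSpace ℝ (Fin d) → M)
    (y z : EuclideanSpace ℝ (Fin d)) :
    stepDiff L (fun y' => stepDiff L' (fun z' => f y' z') z) y =
      stepDiff L' (fun z' => stepDiff L (fun y' => f y' z') y) z := by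
  induction L generalizing y with
  | nil => rfl
  | cons s L ih => simp only [stepDiff, ih, stepDiff_sub]

/-- The difference samples `f` only at points within `totalStep L` of `y`, which stay inside the
ball of differentiability. In the induction, shifting the base point by a step costs its width in
radius. -/
theorem hasLineDerivAt_stepDiff {f : EuclideanSpace ℝ (Fin d) → ℝ} (L : List (Fin d × ℝ))
    {y : EuclideanSpace ℝ (Fin d)} {ρ : ℝ} (hL : totalStep L < ρ)
    (hf : ∀ z ∈ Metric.ball y ρ, DifferentiableAt ℝ f z) (i : Fin d) :
    HasLineDerivAt ℝ (stepDiff L f) (stepDiff L (partialDeriv i f) y) y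
      (EuclideanSpace.single i 1) := by
  induction L generalizing y ρ with
  | nil =>
    refine DifferentiableAt.lineDifferentiableAt (hf y (Metric.mem_ball_self ?_)) |>.hasLineDerivAt
    simpa [totalStep] using hL
  | cons s L ih =>
    rw [totalStep_cons] at hL
    have h1 := ih (y := y) (ρ := ρ) (by linarith [abs_nonneg s.2]) hf
    have h2 := ih (y := y + s.2 • EuclideanSpace.single s.1 1) (ρ := ρ - |s.2|) (by linarith)
      fun z hz => hf z <| by
        rw [Metric.mem_ball] at hz ⊢
        linarith [dist_triangle z (y + s.2 • EuclideanSpace.single s.1 1) y, dist_add_step y s.1 s.2]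
    have h3 := HasDerivAt.sub h2 h1
    refine h3.congr_of_eventuallyEq (Filter.Eventually.of_forall fun t => ?_)
    simp only [stepDiff, Pi.sub_apply]
    congr 2
    abel

/-- A bound for all difference quotients with small steps bounds the derivative. -/
theorem abs_wordDeriv_le {U : Set (EuclideanSpace ℝ (Fin d))} (hU : IsOpen U)
    {f : EuclideanSpace ℝ (Fin d) → ℝ} (w : List (Fin d)) (hf : ContDiffOn ℝ w.length f U)
    {y : EuclideanSpace ℝ (Fin d)} (hy : y ∈ U) {C ε : ℝ} (hε : 0 < ε)
    (h : ∀ L : List (Fin d × ℝ), L.map Prod.fst = w → totalStep L < ε →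
      |stepDiff L f y| ≤ C * prodStep L) : |wordDeriv w f y| ≤ C := by
  induction w generalizing f ε with
  | nil => simpa [prodStep, stepDiff, wordDeriv] using h [] rfl (by simpa [totalStep] using hε)
  | cons i w ih =>
    obtain ⟨ρ, hρ, hball⟩ := Metric.isOpen_iff.1 hU y hy
    refine ih (contDiffOn_partialDeriv hU hf i) (lt_min hε hρ) fun L hw hL => ?_
    -- The bound for the steps `(i, t) :: L`, divided by `|t|`, bounds the slope of `stepDiff L f`
    -- in direction `i`. Letting `t → 0` gives the bound for `partialDeriv i f` along `L`.
    have hder := hasLineDerivAt_stepDiff L (hL.trans_le (min_le_right _ _))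
      (fun z hz => differentiableAt_of_contDiffOn_succ hU hf (hball hz)) i
    have hlim := (hasDerivAt_iff_tendsto_slope.1 hder).abs
    refine le_of_tendsto hlim ?_
    have hsmall : ∀ᶠ t : ℝ in 𝓝[≠] 0, |t| < ε - totalStep L := by
      have h0 : 0 < ε - totalStep L := by linarith [min_le_left ε ρ]
      refine Filter.Eventually.filter_mono nhdsWithin_le_nhds ?_
      filter_upwards [Metric.ball_mem_nhds (0 : ℝ) h0] with t ht
      simpa using ht
    filter_upwards [hsmall, self_mem_nhdsWithin] with t ht ht0
    have ht0' : 0 < |t| := abs_pos.2 ht0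
    have h1 := h ((i, t) :: L) (by simp [hw]) (by rw [totalStep_cons]; simp only; linarith)
    rw [prodStep_cons] at h1
    simp only [stepDiff] at h1
    simp only [slope_def_field, zero_smul, add_zero, sub_zero, abs_div]
    rw [div_le_iff₀ ht0']
    linarith

/-- A bound for a derivative on a ball bounds the corresponding iterated differences. -/
theorem abs_stepDiff_le {x : EuclideanSpace ℝ (Fin d)} {R : ℝ}
    {f : EuclideanSpace ℝ (Fin d) → ℝ} (L : List (Fin d × ℝ))
    (hf : ContDiffOn ℝ L.length f (Metric.ball x R)) {C : ℝ}
    (hC : ∀ z ∈ Metric.ball x R, |wordDeriv (L.map Prod.fst) f z| ≤ C)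
    {y : EuclideanSpace ℝ (Fin d)} (hy : totalStep L + dist y x < R) :
    |stepDiff L f y| ≤ C * prodStep L := by
  induction L generalizing f y with
  | nil => simpa [prodStep, stepDiff, wordDeriv] using hC y (by simpa [totalStep] using hy)
  | cons s L ih =>
    obtain ⟨i, h⟩ := s
    rw [totalStep_cons] at hy
    simp only at hy
    set e : EuclideanSpace ℝ (Fin d) := EuclideanSpace.single i 1 with he
    have hdist : ∀ t : ℝ, dist (y + t • e) x ≤ |t| + dist y x := fun t => by
      linarith [dist_triangle (y + t • e) y x, dist_add_step y i t]
    have hder : ∀ t ∈ Set.uIcc 0 h, HasDerivWithinAt (fun t : ℝ => stepDiff L f (y + t • e))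
        (stepDiff L (partialDeriv i f) (y + t • e)) (Set.uIcc 0 h) t := by
      intro t ht
      have ht' : |t| ≤ |h| := by simpa using Set.abs_sub_left_of_mem_uIcc ht
      have h1 := hasLineDerivAt_stepDiff (f := f) L (y := y + t • e) (ρ := R - dist (y + t • e) x)
        (by linarith [hdist t])
        (fun z hz => differentiableAt_of_contDiffOn_succ Metric.isOpen_ball hf (by
          rw [Metric.mem_ball] at hz ⊢
          linarith [dist_triangle z (y + t • e) x])) i
      -- A line derivative is a derivative at parameter `0`; it is translated here to the parameter
      -- `t`.
      have h2 : HasDerivAt (fun r : ℝ => stepDiff L f (y + t • e + (r - t) • e))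
          (stepDiff L (partialDeriv i f) (y + t • e)) t := by
        have h3 : HasDerivAt (fun r : ℝ => stepDiff L f (y + t • e + r • e))
          (stepDiff L (partialDeriv i f) (y + t • e)) (t - t) := by rw [sub_self]; exact h1
        exact h3.comp_sub_const t t
      refine HasDerivAt.hasDerivWithinAt (h2.congr_of_eventuallyEq
        (Filter.Eventually.of_forall fun r => ?_))
      simp only [add_assoc, ← add_smul, add_sub_cancel]
    have hbd : ∀ t ∈ Set.uIcc 0 h, ‖stepDiff L (partialDeriv i f) (y + t • e)‖ ≤ C * prodStep L := by
      intro t ht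
      have ht' : |t| ≤ |h| := by simpa using Set.abs_sub_left_of_mem_uIcc ht
      exact ih (contDiffOn_partialDeriv Metric.isOpen_ball hf i) hC (by linarith [hdist t])
    -- The mean value inequality on the segment from `y` to `y + h • e` trades one difference for
    -- one derivative and a factor `|h|`.
    have hmv := (convex_uIcc (0 : ℝ) h).norm_image_sub_le_of_norm_hasDerivWithin_le hder hbd
      Set.left_mem_uIcc Set.right_mem_uIcc
    rw [prodStep_cons]
    simp only [zero_smul, add_zero, sub_zero, Real.norm_eq_abs] at hmv
    simp only [stepDiff]
    linarith

/-- Iterated differences in a parameter preserve smoothness and commute with derivatives. -/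
theorem wordDeriv_stepDiff {U : Set (EuclideanSpace ℝ (Fin d))} (hU : IsOpen U)
    {f : EuclideanSpace ℝ (Fin d) → EuclideanSpace ℝ (Fin d) → ℝ} (w : List (Fin d))
    (L : List (Fin d × ℝ)) {y : EuclideanSpace ℝ (Fin d)} {ρ : ℝ} (hL : totalStep L < ρ)
    (hf : ∀ y' ∈ Metric.ball y ρ, ContDiffOn ℝ w.length (f y') U) :
    ContDiffOn ℝ w.length (fun z => stepDiff L (fun y' => f y' z) y) U ∧
    Set.EqOn (wordDeriv w fun z => stepDiff L (fun y' => f y' z) y)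
      (fun z => stepDiff L (fun y' => wordDeriv w (f y') z) y) U := by
  induction L generalizing y ρ with
  | nil =>
    exact ⟨hf y (Metric.mem_ball_self (by simpa [totalStep] using hL)), fun _ _ => rfl⟩
  | cons s L ih =>
    rw [totalStep_cons] at hL
    obtain ⟨h1, h1'⟩ := ih (y := y) (ρ := ρ) (by linarith [abs_nonneg s.2]) hf
    obtain ⟨h2, h2'⟩ := ih (y := y + s.2 • EuclideanSpace.single s.1 1) (ρ := ρ - |s.2|)
      (by linarith) fun z hz => hf z <| by
        rw [Metric.mem_ball] at hz ⊢
        linarith [dist_triangle z (y + s.2 • EuclideanSpace.single s.1 1) y, dist_add_step y s.1 s.2]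
    refine ⟨h2.sub h1, fun z hz => ?_⟩
    have h3 := wordDeriv_sub hU w h2 h1 hz
    rw [Pi.sub_apply, h1' hz, h2' hz] at h3
    exact h3

end StepDiff

/-! ### Smoothness of limits and of scalar products with a feature map -/

section Limits

variable {d : ℕ} {V : Set (EuclideanSpace ℝ (Fin d))}

theorem fderiv_eq_sum_partialDeriv {f : EuclideanSpace ℝ (Fin d) → ℝ}
    {y : EuclideanSpace ℝ (Fin d)} (hf : DifferentiableAt ℝ f y) :
    fderiv ℝ f y = ∑ i, partialDeriv i f y • (EuclideanSpace.proj i : _ →L[ℝ] ℝ) := by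
  ext v
  conv_lhs => rw [← (EuclideanSpace.basisFun (Fin d) ℝ).sum_repr v]
  simp only [map_sum, map_smul, EuclideanSpace.basisFun_apply, EuclideanSpace.basisFun_repr,
    sum_apply, smul_apply, partialDeriv_eq_fderiv hf,
    smul_eq_mul, PiLp.proj_apply]
  exact Finset.sum_congr rfl fun i _ => mul_comm _ _

/-- A pointwise limit of `C^k` functions whose derivatives up to order `k` are uniformly Cauchy is
`C^k`. -/
theorem contDiffOn_of_uniformCauchySeqOn (hV : IsOpen V) (k : ℕ)
    {F : ℕ → EuclideanSpace ℝ (Fin d) → ℝ} {f : EuclideanSpace ℝ (Fin d) → ℝ}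
    (hF : ∀ m, ContDiffOn ℝ k (F m) V)
    (hC : ∀ w : List (Fin d), w.length ≤ k →
      UniformCauchySeqOn (fun m => wordDeriv w (F m)) Filter.atTop V)
    (hlim : ∀ y ∈ V, Filter.Tendsto (fun m => F m y) Filter.atTop (𝓝 (f y))) :
    ContDiffOn ℝ k f V := by
  induction k generalizing F f with
  | zero =>
    have h1 := (hC [] le_rfl).tendstoUniformlyOn_of_tendsto hlim
    have h2 := h1.continuousOn (Filter.Frequently.of_forall fun m => (hF m).continuousOn)
    simpa using h2
  | succ k ih =>
    -- The partial derivatives converge uniformly on `V`, and by induction their limits `g i` are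
    -- `C^k`. Off `V` the value is a dummy.
    have hex : ∀ i : Fin d, ∀ y, ∃ g : ℝ, y ∈ V →
        Filter.Tendsto (fun m => partialDeriv i (F m) y) Filter.atTop (𝓝 g) := by
      intro i y
      by_cases hy : y ∈ V
      · obtain ⟨g, hg⟩ := cauchySeq_tendsto_of_complete
          ((hC [i] (by simp)).cauchySeq hy)
        exact ⟨g, fun _ => hg⟩
      · exact ⟨0, fun h => absurd h hy⟩
    choose g hg using hex
    have hgC : ∀ i, ContDiffOn ℝ k (g i) V := fun i =>
      ih (F := fun m => partialDeriv i (F m)) (fun m => contDiffOn_partialDeriv hV (hF m) i)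
        (fun w hw => hC (i :: w) (by simpa using hw)) (fun y hy => hg i y hy)
    have hunif : ∀ i, TendstoUniformlyOn (fun m => partialDeriv i (F m)) (g i) Filter.atTop V :=
      fun i => (hC [i] (by simp)).tendstoUniformlyOn_of_tendsto fun y hy => hg i y hy
    let T : EuclideanSpace ℝ (Fin d) → (EuclideanSpace ℝ (Fin d) →L[ℝ] ℝ) := fun y =>
      ∑ i, g i y • (EuclideanSpace.proj i : _ →L[ℝ] ℝ)
    have hunif' : TendstoUniformlyOn (fun m => fderiv ℝ (F m)) T Filter.atTop V := by
      have h1 : TendstoUniformlyOn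
          (fun m y => ∑ i, partialDeriv i (F m) y • (EuclideanSpace.proj i : _ →L[ℝ] ℝ)) T
          Filter.atTop V := by
        rw [Metric.tendstoUniformlyOn_iff]
        intro ε hε
        set S := ∑ i : Fin d, ‖(EuclideanSpace.proj i : EuclideanSpace ℝ (Fin d) →L[ℝ] ℝ)‖
        have hS : 0 ≤ S := Finset.sum_nonneg fun _ _ => norm_nonneg _
        -- The summand `1` keeps the denominator positive when `S = 0`, as for `d = 0`.
        have h2 := fun i => Metric.tendstoUniformlyOn_iff.1 (hunif i) (ε / (S + 1)) (by positivity)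
        filter_upwards [Filter.eventually_all.2 h2] with m hm y hy
        rw [dist_eq_norm, ← Finset.sum_sub_distrib]
        calc ‖∑ i, (g i y • (EuclideanSpace.proj i : EuclideanSpace ℝ (Fin d) →L[ℝ] ℝ) -
              partialDeriv i (F m) y • (EuclideanSpace.proj i : _ →L[ℝ] ℝ))‖
            ≤ ∑ i, ε / (S + 1) *
                ‖(EuclideanSpace.proj i : EuclideanSpace ℝ (Fin d) →L[ℝ] ℝ)‖ := by
              refine norm_sum_le_of_le _ fun i _ => ?_
              rw [← sub_smul, norm_smul]
              gcongr
              exact (hm i y hy).le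
          _ = ε * (S / (S + 1)) := by rw [← Finset.mul_sum]; ring
          _ < ε * 1 := by
              gcongr
              rw [div_lt_one (by positivity)]
              linarith
          _ = ε := mul_one ε
      refine h1.congr (Filter.Eventually.of_forall fun m y hy => ?_)
      exact (fderiv_eq_sum_partialDeriv (differentiableAt_of_contDiffOn_succ hV (hF m) hy)).symm
    have hder : ∀ y ∈ V, HasFDerivAt f (T y) y := fun y hy =>
      hasFDerivAt_of_tendstoUniformlyOn hV hunif'
        (fun m z hz => (differentiableAt_of_contDiffOn_succ hV (hF m) hz).hasFDerivAt) hlim hy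
    have hT : ContDiffOn ℝ k T V :=
      ContDiffOn.sum fun i _ => (hgC i).smul contDiffOn_const
    push_cast
    rw [contDiffOn_succ_iff_fderiv_of_isOpen hV]
    exact ⟨fun y hy => (hder y hy).differentiableAt.differentiableWithinAt, by simp,
      hT.congr fun y hy => (hder y hy).fderiv⟩

end Limits

/-! ### Scalar products with a feature map whose difference quotients are bounded -/

section FeatureMap

variable {d : ℕ} {V : Set (EuclideanSpace ℝ (Fin d))}
  {H : Type*} [NormedAddCommGroup H] [InnerProductSpace ℝ H]

/-- If the iterated differences of the feature map `Φ` are bounded by `C` times the step widths,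
then the derivatives of the functions `⟨g, Φ ·⟩` are bounded by `C ‖g‖`. -/
theorem abs_wordDeriv_inner_le (hV : IsOpen V) (Φ : EuclideanSpace ℝ (Fin d) → H)
    (w : List (Fin d)) {C ε : ℝ} (hε : 0 < ε) {y : EuclideanSpace ℝ (Fin d)} (hy : y ∈ V)
    (hC : ∀ L : List (Fin d × ℝ), L.map Prod.fst = w → totalStep L < ε →
      ‖stepDiff L Φ y‖ ≤ C * prodStep L) (g : H)
    (hg : ContDiffOn ℝ w.length (fun z => inner ℝ g (Φ z)) V) :
    |wordDeriv w (fun z => inner ℝ g (Φ z)) y| ≤ C * ‖g‖ := by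
  refine abs_wordDeriv_le hV w hg hy hε fun L hw hL => ?_
  have h1 := map_stepDiff (innerSL ℝ g : H →L[ℝ] ℝ).toLinearMap.toAddMonoidHom L Φ y
  have h2 : stepDiff L (fun z => inner ℝ g (Φ z)) y = inner ℝ g (stepDiff L Φ y) := h1.symm
  rw [h2]
  calc |inner ℝ g (stepDiff L Φ y)| ≤ ‖g‖ * ‖stepDiff L Φ y‖ := abs_real_inner_le_norm _ _
    _ ≤ ‖g‖ * (C * prodStep L) := by gcongr; exact hC L hw hL
    _ = C * ‖g‖ * prodStep L := by ring

/-- For `g` in the span of `Φ '' V` smoothness is the hypothesis `hΦ`. The bound `C ‖g‖` on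
derivatives carries it to the closure of the span, and the component of `g` orthogonal to that
closure is invisible on `V`. Differentiability of `Φ` itself in `H` is not needed. -/
theorem contDiffOn_inner_of_stepDiff_le [CompleteSpace H] (hV : IsOpen V) (k : ℕ)
    (Φ : EuclideanSpace ℝ (Fin d) → H)
    (hΦ : ∀ z ∈ V, ContDiffOn ℝ k (fun y => inner ℝ (Φ z) (Φ y)) V)
    (hC : ∀ w : List (Fin d), w.length ≤ k → ∃ C : ℝ, ∃ ε > 0, ∀ y ∈ V, ∀ L : List (Fin d × ℝ),
      L.map Prod.fst = w → totalStep L < ε → ‖stepDiff L Φ y‖ ≤ C * prodStep L) (g : H) :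
    ContDiffOn ℝ k (fun y => inner ℝ g (Φ y)) V := by
  set D := Submodule.span ℝ (Φ '' V) with hD
  have hDsm : ∀ g ∈ D, ContDiffOn ℝ k (fun y => inner ℝ g (Φ y)) V := by
    intro g hg
    induction hg using Submodule.span_induction with
    | mem g hg => obtain ⟨z, hz, rfl⟩ := hg; exact hΦ z hz
    | zero => simpa using contDiffOn_const
    | add g g' _ _ h h' => simpa only [inner_add_left] using h.add h'
    | smul r g _ h => simpa only [real_inner_smul_left] using contDiffOn_const.mul h
  set W := D.topologicalClosure
  have : CompleteSpace W := D.isClosed_topologicalClosure.completeSpace_coe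
  have hproj : ∀ y ∈ V, inner ℝ g (Φ y) = inner ℝ (W.starProjection g) (Φ y) := by
    intro y hy
    have hy' : Φ y ∈ W := D.le_topologicalClosure (Submodule.subset_span ⟨y, hy, rfl⟩)
    have := W.starProjection_inner_eq_zero g (Φ y) hy'
    rw [inner_sub_left] at this
    linarith
  refine ContDiffOn.congr ?_ hproj
  obtain ⟨G, hGD, hG⟩ := mem_closure_iff_seq_limit.1
    (show W.starProjection g ∈ closure (D : Set H) from W.starProjection_apply_mem g)
  refine contDiffOn_of_uniformCauchySeqOn hV k (F := fun m y => inner ℝ (G m) (Φ y))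
    (fun m => hDsm _ (hGD m)) (fun w hw => ?_) fun y _ => hG.inner tendsto_const_nhds
  obtain ⟨C, ε, hε, hC⟩ := hC w hw
  rw [Metric.uniformCauchySeqOn_iff]
  intro η hη
  obtain ⟨m₀, hm₀⟩ := Metric.cauchySeq_iff.1 hG.cauchySeq (η / (|C| + 1)) (by positivity)
  refine ⟨m₀, fun m hm n hn y hy => ?_⟩
  have hw' : (w.length : WithTop ℕ∞) ≤ k := by exact_mod_cast hw
  have h1 := abs_wordDeriv_inner_le hV Φ w hε hy (hC y hy) (G m - G n)
    ((hDsm _ (D.sub_mem (hGD m) (hGD n))).of_le hw')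
  have h2 := wordDeriv_sub hV w ((hDsm _ (hGD m)).of_le hw') ((hDsm _ (hGD n)).of_le hw') hy
  have h3 : (fun y => inner ℝ (G m - G n) (Φ y)) =
      (fun y => inner ℝ (G m) (Φ y)) - fun y => inner ℝ (G n) (Φ y) := by
    funext y; simp [inner_sub_left]
  rw [h3, h2] at h1
  rw [Real.dist_eq]
  have h4 : ‖G m - G n‖ < η / (|C| + 1) := by simpa [dist_eq_norm] using hm₀ m hm n hn
  calc _ ≤ C * ‖G m - G n‖ := h1
    _ ≤ (|C| + 1) * ‖G m - G n‖ := by gcongr; linarith [le_abs_self C]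
    _ < (|C| + 1) * (η / (|C| + 1)) := by gcongr
    _ = η := by field_simp

end FeatureMap

/-! ### Representing functions of the native space -/

section Feature

variable {Ω : Type*} {K : Ω → Ω → ℝ} {P : Submodule ℝ (Ω → ℝ)}

theorem pairing_eq_linearCombination (c : Ω →₀ ℝ) (f : Ω → ℝ) :
    pairing c f = Finsupp.linearCombination ℝ f c := rfl

theorem inner_coe_eq_pairing (h : IsCPDKernel K P) (c c' : PreNative K P h) :
    inner ℝ (c : NativeHilbert h) (c' : NativeHilbert h) =
      pairing (c'.coeff h) fun z => pairing (c.coeff h) fun y => K y z := by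
  rw [UniformSpace.Completion.inner_coe]
  change kernelForm K (c.coeff h) (c'.coeff h) = _
  simp only [kernelForm, pairing, Finsupp.sum, Finset.mul_sum]
  rw [Finset.sum_comm]
  exact Finset.sum_congr rfl fun _ _ => Finset.sum_congr rfl fun _ _ => by ring

/-- Elements of the pre-Hilbert space represent linear combinations of translates of the kernel. -/
theorem represents_coe (h : IsCPDKernel K P) (c : PreNative K P h) :
    Represents h (c : NativeHilbert h) fun z => pairing (c.coeff h) fun y => K y z :=
  fun c' => (inner_coe_eq_pairing h c c').symm

theorem represents_zero_of_mem (h : IsCPDKernel K P) {p : Ω → ℝ} (hp : p ∈ P) :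
    Represents h 0 p := fun c => by
  rw [inner_zero_left]; exact c.2 p hp

theorem le_nativeSpace (h : IsCPDKernel K P) : P ≤ nativeSpace h :=
  fun _ hp => ⟨0, represents_zero_of_mem h hp⟩

/-- The functions `ℓ ξ`, `ξ ∈ Ξ`, lie in `P` and reproduce `P` from its values on `Ξ`. -/
structure IsReproducing (P : Submodule ℝ (Ω → ℝ)) (Ξ : Finset Ω) (ℓ : Ω → Ω → ℝ) : Prop where
  mem : ∀ ξ, ℓ ξ ∈ P
  eq_sum : ∀ p ∈ P, ∀ z, p z = ∑ ξ ∈ Ξ, ℓ ξ z * p ξ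

variable {Ξ : Finset Ω} {ℓ : Ω → Ω → ℝ}

theorem pairing_single_sub (Ξ : Finset Ω) (ℓ : Ω → Ω → ℝ) (z : Ω) (f : Ω → ℝ) :
    pairing (Finsupp.single z 1 - ∑ ξ ∈ Ξ, ℓ ξ z • Finsupp.single ξ 1) f =
      f z - ∑ ξ ∈ Ξ, ℓ ξ z * f ξ := by
  simp [pairing_eq_linearCombination]

/-- The element `δ_z - ∑ ℓ_ξ(z) δ_ξ` of the pre-Hilbert space. -/
def featureVec (h : IsCPDKernel K P) (hℓ : IsReproducing P Ξ ℓ) (z : Ω) : PreNative K P h :=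
  ⟨Finsupp.single z 1 - ∑ ξ ∈ Ξ, ℓ ξ z • Finsupp.single ξ 1, fun p hp => by
    rw [pairing_single_sub, ← hℓ.eq_sum p hp, sub_self]⟩

theorem pairing_featureVec (h : IsCPDKernel K P) (hℓ : IsReproducing P Ξ ℓ) (z : Ω)
    (f : Ω → ℝ) :
    pairing ((featureVec h hℓ z).coeff h) f = f z - ∑ ξ ∈ Ξ, ℓ ξ z * f ξ :=
  pairing_single_sub Ξ ℓ z f

/-- Pairing `f` with `featureVec` splits it into its Hilbert space part and an element of `P`. -/
theorem Represents.apply_eq {h : IsCPDKernel K P} (hℓ : IsReproducing P Ξ ℓ)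
    {g : NativeHilbert h} {f : Ω → ℝ} (hf : Represents h g f) (z : Ω) :
    f z = inner ℝ g (featureVec h hℓ z : NativeHilbert h) + ∑ ξ ∈ Ξ, ℓ ξ z * f ξ := by
  rw [← hf, pairing_featureVec]; ring

theorem IsReproducing.sum_mem (hℓ : IsReproducing P Ξ ℓ) (f : Ω → ℝ) :
    (fun z => ∑ ξ ∈ Ξ, ℓ ξ z * f ξ) ∈ P := by
  have : (fun z => ∑ ξ ∈ Ξ, ℓ ξ z * f ξ) = ∑ ξ ∈ Ξ, f ξ • ℓ ξ := by
    funext z; simp [Finset.sum_apply, mul_comm]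
  rw [this]
  exact P.sum_mem fun ξ _ => P.smul_mem _ (hℓ.mem ξ)

/-- Every element of the Hilbert space represents a function. -/
theorem represents_inner_featureVec (h : IsCPDKernel K P) (hℓ : IsReproducing P Ξ ℓ)
    (g : NativeHilbert h) :
    Represents h g fun z => inner ℝ g (featureVec h hℓ z : NativeHilbert h) := by
  intro c
  induction g using UniformSpace.Completion.induction_on with
  | hp =>
    refine isClosed_eq ?_ (by fun_prop)
    simp only [pairing, Finsupp.sum]
    fun_prop
  | ih a =>
    -- By density `g` is a coefficient family `a`. The function `κ` it represents differs from `⟨a,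
    -- Φ(·)⟩` by an element of `P`, which `c` annihilates.
    have h1 := represents_coe h a
    set κ : Ω → ℝ := fun z => pairing (a.coeff h) fun y => K y z
    have h2 : κ = (fun z => inner ℝ (a : NativeHilbert h) (featureVec h hℓ z : NativeHilbert h)) +
        fun z => ∑ ξ ∈ Ξ, ℓ ξ z * κ ξ := by
      funext z; exact h1.apply_eq hℓ z
    have h3 := h1 c
    rw [h2, pairing_add] at h3
    have h4 : pairing (c.coeff h) (fun z => ∑ ξ ∈ Ξ, ℓ ξ z * κ ξ) = 0 := c.2 _ (hℓ.sum_mem κ)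
    rw [h4, add_zero] at h3
    exact h3

end Feature

/-! ### Optimal recovery in native spaces -/

section Recovery

/-- The finite-dimensional double annihilator property. It produces the polynomial in the kernel
system from an orthogonality relation. -/
theorem mem_of_forall_dotProduct {n : ℕ} (W : Submodule ℝ (Fin n → ℝ)) (v : Fin n → ℝ)
    (hv : ∀ c : Fin n → ℝ, (∀ w ∈ W, ∑ i, c i * w i = 0) → ∑ i, c i * v i = 0) : v ∈ W := by
  by_contra hvW
  obtain ⟨f, hfv, hf⟩ := Submodule.exists_le_ker_of_notMem hvW
  have key : ∀ w, f w = ∑ i, f (Pi.single i 1) * w i := fun w => by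
    rw [LinearMap.pi_apply_eq_sum_univ f w]
    refine Finset.sum_congr rfl fun i _ => ?_
    rw [smul_eq_mul, mul_comm]
    congr 2
    ext j
    simp [Pi.single_apply, eq_comm]
  refine hfv ?_
  rw [key]
  refine hv _ fun w hw => ?_
  rw [← key]
  exact hf hw

variable {Ω : Type*} {K : Ω → Ω → ℝ} {P : Submodule ℝ (Ω → ℝ)} {n : ℕ}
  {Ξ : Finset Ω} {ℓ : Ω → Ω → ℝ}

/-- The coefficient vectors on the nodes `X` that annihilate `P`. -/
def nodeAnnihilator (P : Submodule ℝ (Ω → ℝ)) (X : Fin n → Ω) : Submodule ℝ (Fin n → ℝ) where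
  carrier := {c | ∀ p ∈ P, ∑ i, c i * p (X i) = 0}
  zero_mem' := by intro p _; simp
  add_mem' := by
    intro c c' hc hc' p hp
    simp only [Pi.add_apply, add_mul, Finset.sum_add_distrib, hc p hp, hc' p hp, add_zero]
  smul_mem' := by
    intro r c hc p hp
    simp only [Pi.smul_apply, smul_eq_mul, mul_assoc, ← Finset.mul_sum, hc p hp, mul_zero]

theorem pairing_sum_single (X : Fin n → Ω) (c : Fin n → ℝ) (f : Ω → ℝ) :
    pairing (Fintype.linearCombination ℝ (fun i => Finsupp.single (X i) (1 : ℝ)) c) f =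
      ∑ i, c i * f (X i) := by
  simp [pairing_eq_linearCombination, Fintype.linearCombination_apply]

/-- The inclusion of the annihilating coefficient vectors on the nodes into the pre-Hilbert
space. -/
def nodeMap (h : IsCPDKernel K P) (X : Fin n → Ω) : nodeAnnihilator P X →ₗ[ℝ] PreNative K P h :=
  LinearMap.restrict (q := annihilator P)
    (Fintype.linearCombination ℝ fun i => Finsupp.single (X i) (1 : ℝ))
    fun c hc p hp => by rw [pairing_sum_single]; exact hc p hp

theorem pairing_nodeMap (h : IsCPDKernel K P) (X : Fin n → Ω) (c : nodeAnnihilator P X)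
    (f : Ω → ℝ) : pairing ((nodeMap h X c).coeff h) f = ∑ i, c.1 i * f (X i) :=
  pairing_sum_single X c f

theorem nodeMap_injective (h : IsCPDKernel K P) {X : Fin n → Ω} (hX : Function.Injective X) :
    Function.Injective (nodeMap h X) := by
  classical
  rw [injective_iff_map_eq_zero]
  intro c hc
  ext i
  -- Since the nodes are distinct, the indicator of `X i` isolates the coefficient `c i`.
  have h1 := pairing_nodeMap h X c (Pi.single (X i) 1)
  rw [hc, Finset.sum_eq_single i] at h1
  · have h2 : pairing (PreNative.coeff h 0) (Pi.single (X i) 1) = 0 := Finsupp.sum_zero_index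
    rw [h2] at h1
    simpa using h1.symm
  · intro j _ hj
    simp [hX.eq_iff, hj]
  · simp

/-- The vector `v` of the Hilbert space represents the error functional of the formula `u`. -/
def IsErrorVec (h : IsCPDKernel K P) (lam : (Ω → ℝ) → ℝ) (X : Fin n → Ω) (u : Fin n → ℝ)
    (v : NativeHilbert h) : Prop :=
  ∀ g f, Represents h g f → lam f - ∑ i, u i * f (X i) = inner ℝ v g

/-- The properties of a functional needed for the recovery from function values in the native
space: linearity on a space `S` of functions containing the native space and the translates of the
kernel, and boundedness with respect to the seminorm of the native space. -/
structure IsRecoverable (h : IsCPDKernel K P) (hℓ : IsReproducing P Ξ ℓ) (S : Submodule ℝ (Ω → ℝ)) (lam : (Ω → ℝ) → ℝ) :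
    Prop where
  map_add : ∀ f ∈ S, ∀ f' ∈ S, lam (f + f') = lam f + lam f'
  map_smul : ∀ (r : ℝ), ∀ f ∈ S, lam (r • f) = r * lam f
  native_le : nativeSpace h ≤ S
  kernel_mem : ∀ y, (fun z => K z y) ∈ S
  bounded : ∃ C, ∀ g : NativeHilbert h,
    |lam fun z => inner ℝ g (featureVec h hℓ z : NativeHilbert h)| ≤ C * ‖g‖

/-- The error of the formula `u`, applied to the second argument of the kernel. -/
def kernelError (K : Ω → Ω → ℝ) (lam : (Ω → ℝ) → ℝ) (X : Fin n → Ω) (u : Fin n → ℝ) (z : Ω) : ℝ :=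
  lam (fun y => K z y) - ∑ i, u i * K z (X i)

variable {h : IsCPDKernel K P} {hℓ : IsReproducing P Ξ ℓ} {S : Submodule ℝ (Ω → ℝ)} {lam : (Ω → ℝ) → ℝ}

theorem IsRecoverable.map_zero (hl : IsRecoverable h hℓ S lam) : lam 0 = 0 := by
  simpa using hl.map_smul 0 0 S.zero_mem

theorem IsRecoverable.map_sum_smul (hl : IsRecoverable h hℓ S lam) {ι : Type*} (t : Finset ι)
    (c : ι → ℝ) (f : ι → Ω → ℝ) (hf : ∀ i, f i ∈ S) :
    lam (∑ i ∈ t, c i • f i) = ∑ i ∈ t, c i * lam (f i) := by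
  classical
  induction t using Finset.induction_on with
  | empty => simp [hl.map_zero]
  | insert i t hi ih =>
    rw [Finset.sum_insert hi, Finset.sum_insert hi, hl.map_add _ (S.smul_mem _ (hf i)) _
      (S.sum_mem fun j _ => S.smul_mem _ (hf j)), hl.map_smul _ _ (hf i), ih]

theorem IsRecoverable.kernel_mem' (hl : IsRecoverable h hℓ S lam) (y : Ω) :
    (fun z => K y z) ∈ S := by
  simpa only [h.symm y] using hl.kernel_mem y

/-- The error functionals of exact formulas are represented in the Hilbert space. -/
theorem IsRecoverable.exists_errorVec (hl : IsRecoverable h hℓ S lam) (X : Fin n → Ω)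
    (u : Fin n → ℝ) (hu : IsExact P lam X u) :
    ∃ v : NativeHilbert h, IsErrorVec h lam X u v := by
  obtain ⟨C, hC⟩ := hl.bounded
  let F : NativeHilbert h → Ω → ℝ := fun g z => inner ℝ g (featureVec h hℓ z : NativeHilbert h)
  have hF : ∀ g, Represents h g (F g) := represents_inner_featureVec h hℓ
  have hFS : ∀ g, F g ∈ S := fun g => hl.native_le ⟨g, hF g⟩
  let Λ : NativeHilbert h →ₗ[ℝ] ℝ :=
    { toFun := fun g => lam (F g)
      map_add' := fun g g' => by
        have : F (g + g') = F g + F g' := funext fun z => inner_add_left _ _ _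
        rw [this, hl.map_add _ (hFS g) _ (hFS g')]
      map_smul' := fun r g => by
        have : F (r • g) = r • F g := funext fun z => real_inner_smul_left _ _ _
        rw [this, hl.map_smul _ _ (hFS g)]; rfl }
  let vl : NativeHilbert h := (InnerProductSpace.toDual ℝ _).symm (Λ.mkContinuous C hC)
  have hvl : ∀ g, inner ℝ vl g = lam (F g) := fun g => InnerProductSpace.toDual_symm_apply
  -- The Riesz vector `vl` represents `lam` on the functions `F g`. For general `f = F g + p`,
  -- exactness cancels the contribution of `p`.
  refine ⟨vl - ∑ i, u i • (featureVec h hℓ (X i) : NativeHilbert h), fun g f hf => ?_⟩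
  have hp := hℓ.sum_mem f
  set p : Ω → ℝ := fun z => ∑ ξ ∈ Ξ, ℓ ξ z * f ξ
  have hfp : f = F g + p := funext fun z => hf.apply_eq hℓ z
  have hlp := hu p hp
  have h1 : ∀ i, inner ℝ (featureVec h hℓ (X i) : NativeHilbert h) g = F g (X i) :=
    fun i => real_inner_comm _ _
  rw [inner_sub_left, sum_inner, hvl]
  simp only [real_inner_smul_left, h1]
  rw [hfp, hl.map_add _ (hFS g) _ (hl.native_le (le_nativeSpace h hp)), ← hlp]
  simp only [Pi.add_apply, mul_add, Finset.sum_add_distrib]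
  ring

variable {X : Fin n → Ω}

theorem represents_nativeRep (h : IsCPDKernel K P) (f : nativeSpace h) :
    Represents h (nativeRep h f) f.1 := Classical.choose_spec f.2

/-- Cauchy–Schwarz gives the upper bound; the function represented by `v / ‖v‖` attains it. -/
theorem worstCaseError_eq (hℓ : IsReproducing P Ξ ℓ) {u : Fin n → ℝ} {v : NativeHilbert h}
    (hv : IsErrorVec h lam X u v) : worstCaseError h lam X u = ENNReal.ofReal ‖v‖ := by
  refine le_antisymm (iSup₂_le fun f hf => ENNReal.ofReal_le_ofReal ?_) ?_
  · rw [hv _ _ (represents_nativeRep h f)]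
    calc _ ≤ ‖v‖ * ‖nativeRep h f‖ := abs_real_inner_le_norm _ _
      _ ≤ ‖v‖ * 1 := by gcongr; exact hf
      _ = ‖v‖ := mul_one _
  · set g : NativeHilbert h := ‖v‖⁻¹ • v with hg
    have hr := represents_inner_featureVec h hℓ g
    set f : Ω → ℝ := fun z => inner ℝ g (featureVec h hℓ z : NativeHilbert h)
    let f' : nativeSpace h := ⟨f, g, hr⟩
    have hrep : nativeRep h f' = g := Represents.unique h (represents_nativeRep h f') hr
    have hnorm : nativeSeminorm h f' ≤ 1 := by
      rw [nativeSeminorm, hrep, hg, norm_smul, norm_inv, norm_norm]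
      exact inv_mul_le_one
    refine le_trans (le_of_eq ?_) (le_iSup₂ f' hnorm)
    rw [hv g f hr, hg, real_inner_smul_right, real_inner_self_eq_norm_sq]
    congr 1
    -- For `v = 0` the convention `0⁻¹ = 0` makes `g = 0`, and both sides vanish.
    rcases eq_or_ne ‖v‖ 0 with h0 | h0
    · simp [h0]
    · rw [sq, inv_mul_cancel_left₀ h0, abs_norm]

/-- The function represented by `c` is a finite combination of the `K y ·`. Evaluating the error
functional on it term by term is the same as pairing `c` with `kernelError`. -/
theorem IsRecoverable.represents_kernelError (hl : IsRecoverable h hℓ S lam) {u : Fin n → ℝ}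
    {v : NativeHilbert h} (hv : IsErrorVec h lam X u v) :
    Represents h v (kernelError K lam X u) := by
  intro c
  have h1 := hv _ _ (represents_coe h c)
  have h2 : (fun z => pairing (c.coeff h) fun y => K y z) =
      ∑ y ∈ (c.coeff h).support, c.coeff h y • fun z => K y z := by
    funext z; simp [pairing, Finsupp.sum, Finset.sum_apply]
  rw [← h1, h2, hl.map_sum_smul _ _ _ hl.kernel_mem']
  simp only [pairing, Finsupp.sum, kernelError, mul_sub, Finset.sum_sub_distrib, Finset.mul_sum]
  congr 1
  rw [Finset.sum_comm]
  exact Finset.sum_congr rfl fun _ _ => Finset.sum_congr rfl fun _ _ => by ring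

/-- As `v` represents `kernelError`, `⟨v, v⟩` is the error functional applied to `kernelError`.
Membership of `kernelError` in `S` is also what permits applying `lam` linearly to `y ↦ lam (K y
·)`. -/
theorem IsRecoverable.norm_sq_errorVec (hl : IsRecoverable h hℓ S lam) {u : Fin n → ℝ}
    {v : NativeHilbert h} (hv : IsErrorVec h lam X u v) :
    ‖v‖ ^ 2 = lam (fun y => lam (fun z => K y z))
      - ∑ i, u i * (lam (fun y => K y (X i)) + lam (fun z => K (X i) z))
      + ∑ i, ∑ j, u i * u j * K (X i) (X j) := by
  have hκ := hl.represents_kernelError hv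
  have hκS : kernelError K lam X u ∈ S := hl.native_le ⟨v, hκ⟩
  have h1 := hv _ _ hκ
  rw [real_inner_self_eq_norm_sq] at h1
  have hsum : (∑ i, u i • fun z => K z (X i)) ∈ S :=
    S.sum_mem fun i _ => S.smul_mem _ (hl.kernel_mem _)
  have h2 : (fun y => lam fun z => K y z) =
      kernelError K lam X u + ∑ i, u i • fun z => K z (X i) := by
    funext z; simp [kernelError, Finset.sum_apply]
  have h3 : lam (fun y => lam fun z => K y z) =
      lam (kernelError K lam X u) + ∑ i, u i * lam (fun y => K y (X i)) := by
    rw [h2, hl.map_add _ hκS _ hsum, hl.map_sum_smul _ _ _ fun i => hl.kernel_mem _]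
  rw [h3, ← h1]
  simp only [kernelError, mul_add, mul_sub, Finset.sum_add_distrib, Finset.sum_sub_distrib,
    Finset.mul_sum, mul_assoc]
  ring

/-- Subtracting `c` from the weights adds `∑ c_i f(X_i)` to the error, and this is the pairing with
`nodeMap h X c`. -/
theorem IsErrorVec.eq_add_nodeMap (hℓ : IsReproducing P Ξ ℓ) {u w : Fin n → ℝ}
    {v v' : NativeHilbert h} (hv : IsErrorVec h lam X u v) (hv' : IsErrorVec h lam X w v')
    (c : nodeAnnihilator P X) (hc : u = w - c.1) :
    v = v' + (nodeMap h X c : NativeHilbert h) := by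
  refine ext_inner_right ℝ fun g => ?_
  have hr := represents_inner_featureVec h hℓ g
  rw [inner_add_left, ← hv g _ hr, ← hv' g _ hr, real_inner_comm, ← hr, pairing_nodeMap, hc]
  simp only [Pi.sub_apply, sub_mul, Finset.sum_sub_distrib]
  ring

theorem IsExact.sub_mem {u w : Fin n → ℝ} (hu : IsExact P lam X u) (hw : IsExact P lam X w) :
    w - u ∈ nodeAnnihilator P X := fun p hp => by
  simp only [Pi.sub_apply, sub_mul, Finset.sum_sub_distrib, hu p hp, hw p hp, sub_self]

/-- The kernel-based weights are the exact formulas whose error functional is orthogonal to the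
annihilating functionals on the nodes. -/
theorem IsRecoverable.isKernelWeights_iff (hl : IsRecoverable h hℓ S lam) {w : Fin n → ℝ}
    (hw : IsExact P lam X w) {v : NativeHilbert h} (hv : IsErrorVec h lam X w v) :
    IsKernelWeights K P lam X w ↔
      ∀ c : nodeAnnihilator P X, inner ℝ v (nodeMap h X c : NativeHilbert h) = 0 := by
  have hκ := hl.represents_kernelError hv
  have hκX : ∀ i, kernelError K lam X w (X i) =
      lam (fun y => K y (X i)) - ∑ j, w j * K (X i) (X j) := fun i => by
    simp only [kernelError, fun y => h.symm y (X i)]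
  have hin : ∀ c : nodeAnnihilator P X, inner ℝ v (nodeMap h X c : NativeHilbert h) =
      ∑ i, c.1 i * kernelError K lam X w (X i) := fun c => by
    rw [← hκ, pairing_nodeMap]
  constructor
  · rintro ⟨⟨p, hp, hpX⟩, -⟩ c
    rw [hin, ← c.2 p hp]
    refine Finset.sum_congr rfl fun i _ => ?_
    rw [hκX, ← hpX i, add_sub_cancel_left]
  · intro hc
    let res : (Ω → ℝ) →ₗ[ℝ] (Fin n → ℝ) := LinearMap.funLeft ℝ ℝ X
    -- Orthogonality says that the node values of `kernelError` are killed by every vector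
    -- annihilating `P` on the nodes, so they are the node values of some `p ∈ P`.
    obtain ⟨p, hp, hpX⟩ := mem_of_forall_dotProduct (P.map res)
      (fun i => kernelError K lam X w (X i)) fun c hcP => by
        have hcA : c ∈ nodeAnnihilator P X := fun p hp => hcP _ (Submodule.mem_map_of_mem hp)
        rw [← hin ⟨c, hcA⟩, hc]
    refine ⟨⟨p, hp, fun i => ?_⟩, hw⟩
    have h1 : p (X i) = kernelError K lam X w (X i) := congrFun hpX i
    rw [h1, hκX, add_sub_cancel]

theorem IsRecoverable.existsUnique_isKernelWeights (hl : IsRecoverable h hℓ S lam)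
    (hX : Function.Injective X) (hex : ∃ u, IsExact P lam X u) :
    ∃! w, IsKernelWeights K P lam X w := by
  obtain ⟨u, hu⟩ := hex
  obtain ⟨v, hv⟩ := hl.exists_errorVec X u hu
  let T : nodeAnnihilator P X →ₗ[ℝ] NativeHilbert h :=
    (UniformSpace.Completion.toComplₗᵢ (𝕜 := ℝ)).toLinearMap ∘ₗ nodeMap h X
  -- Adding to `u` the coefficients `c` of the projection of `v` replaces `v` by `v - T c`, which is
  -- orthogonal to the range of `T`.
  obtain ⟨c, hc⟩ : T.range.starProjection v ∈ T.range := T.range.starProjection_apply_mem v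
  have hw : IsExact P lam X (u + c.1) := fun p hp => by
    simp only [Pi.add_apply, add_mul, Finset.sum_add_distrib, hu p hp, c.2 p hp, add_zero]
  obtain ⟨v', hv'⟩ := hl.exists_errorVec X _ hw
  have hvv' : v = v' + T c := IsErrorVec.eq_add_nodeMap hℓ hv hv' c (by simp)
  refine ⟨u + c.1, (hl.isKernelWeights_iff hw hv').2 fun b => ?_, fun w' hw' => ?_⟩
  · have h1 := T.range.starProjection_inner_eq_zero v (T b) ⟨b, rfl⟩
    rwa [← hc, hvv', add_sub_cancel_right] at h1
  · obtain ⟨v₁, hv₁⟩ := hl.exists_errorVec X _ hw'.2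
    have horth : ∀ b, inner ℝ v' (T b) = 0 := fun b => by
      have h1 := T.range.starProjection_inner_eq_zero v (T b) ⟨b, rfl⟩
      rwa [← hc, hvv', add_sub_cancel_right] at h1
    have horth₁ : ∀ b, inner ℝ v₁ (T b) = 0 := (hl.isKernelWeights_iff hw'.2 hv₁).1 hw'
    let b : nodeAnnihilator P X := ⟨(u + c.1) - w', hw'.2.sub_mem hw⟩
    have h2 : v₁ = v' + T b := IsErrorVec.eq_add_nodeMap hℓ hv₁ hv' b (by simp [b])
    -- Both error vectors are orthogonal to `T b`, which is their difference; hence `⟨T b, T b⟩ =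
    -- 0`.
    have h3 : T b = 0 := by
      have h4 := horth₁ b
      rw [h2, inner_add_left, horth b, zero_add] at h4
      exact inner_self_eq_zero.1 h4
    have h5 : nodeMap h X b = 0 := by
      rw [← UniformSpace.Completion.coe_eq_zero_iff]; exact h3
    have h6 : b = 0 := nodeMap_injective h hX (by rw [h5, LinearMap.map_zero])
    exact (sub_eq_zero.1 (congrArg Subtype.val h6)).symm

/-- Pythagoras: any other exact formula has error vector `v'` plus a vector orthogonal to `v'`. -/
theorem IsRecoverable.isLeast_worstCaseError (hl : IsRecoverable h hℓ S lam) {w : Fin n → ℝ}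
    (hw : IsKernelWeights K P lam X w) :
    IsLeast ((fun u => worstCaseError h lam X u) '' {u | IsExact P lam X u})
      (worstCaseError h lam X w) := by
  refine ⟨⟨w, hw.2, rfl⟩, ?_⟩
  rintro _ ⟨u, hu, rfl⟩
  obtain ⟨v, hv⟩ := hl.exists_errorVec X u hu
  obtain ⟨v', hv'⟩ := hl.exists_errorVec X w hw.2
  simp only [worstCaseError_eq hℓ hv, worstCaseError_eq hℓ hv']
  let b : nodeAnnihilator P X := ⟨w - u, IsExact.sub_mem hu hw.2⟩
  have h1 := IsErrorVec.eq_add_nodeMap hℓ hv hv' b (by simp [b])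
  have h2 := (hl.isKernelWeights_iff hw.2 hv').1 hw b
  have h3 := norm_add_sq_eq_norm_sq_add_norm_sq_of_inner_eq_zero _ _ h2
  rw [← h1] at h3
  refine ENNReal.ofReal_le_ofReal ((sq_le_sq₀ (norm_nonneg _) (norm_nonneg _)).1 ?_)
  nlinarith [mul_self_nonneg ‖(nodeMap h X b : NativeHilbert h)‖]

end Recovery

/-! ### Polynomials -/

section Polynomials

variable {d q : ℕ}

/-- Beyond smoothness, analyticity gives the identity theorem: a polynomial vanishing on a nonempty
open set is zero. -/
theorem analyticOnNhd_of_mem_polySpace {p : EuclideanSpace ℝ (Fin d) → ℝ}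
    (hp : p ∈ polySpace d q) : AnalyticOnNhd ℝ p Set.univ := by
  induction hp using Submodule.span_induction with
  | mem p hp =>
    obtain ⟨α, -, rfl⟩ := hp
    refine Finset.analyticOnNhd_fun_prod _ fun i _ => AnalyticOnNhd.pow ?_ _
    exact (EuclideanSpace.proj i : EuclideanSpace ℝ (Fin d) →L[ℝ] ℝ).analyticOnNhd _
  | zero => exact analyticOnNhd_const
  | add f g _ _ hf hg => exact hf.add hg
  | smul r f _ hf => exact (analyticOnNhd_const (v := r)).smul hf

theorem contDiff_of_mem_polySpace {p : EuclideanSpace ℝ (Fin d) → ℝ}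
    (hp : p ∈ polySpace d q) {k : ℕ} : ContDiff ℝ k p :=
  (analyticOnNhd_of_mem_polySpace hp).contDiff

instance : FiniteDimensional ℝ (polySpace d q) := by
  refine FiniteDimensional.span_of_finite ℝ ?_
  have hfin : {α : Fin d → ℕ | ∑ i, α i < q}.Finite := by
    refine (Set.Finite.pi (t := fun _ : Fin d => Set.Iio q) fun _ => Set.finite_Iio q).subset ?_
    intro α hα i _
    exact (Finset.single_le_sum (f := α) (fun _ _ => Nat.zero_le _) (Finset.mem_univ i)).trans_lt hα
  refine (hfin.image fun α => fun x : EuclideanSpace ℝ (Fin d) => ∏ i, x i ^ α i).subset ?_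
  rintro p ⟨α, hα, rfl⟩
  exact ⟨α, hα, rfl⟩

/-- A nonempty open set contains nodes from which the polynomials can be reproduced. -/
theorem exists_isReproducing_polySpace (d q : ℕ) {U : Set (EuclideanSpace ℝ (Fin d))}
    (hU : IsOpen U) (hne : U.Nonempty) :
    ∃ (Ξ : Finset (EuclideanSpace ℝ (Fin d)))
      (ℓ : EuclideanSpace ℝ (Fin d) → EuclideanSpace ℝ (Fin d) → ℝ),
      (∀ ξ ∈ Ξ, ξ ∈ U) ∧ IsReproducing (polySpace d q) Ξ ℓ := by
  classical
  set P := polySpace d q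
  let ev : EuclideanSpace ℝ (Fin d) → Module.Dual ℝ P := fun z => LinearMap.proj z ∘ₗ P.subtype
  -- If the evaluations on `U` did not span the dual, reflexivity would give a nonzero `p` vanishing
  -- on `U`.
  have hspan : ∀ φ, φ ∈ Submodule.span ℝ (ev '' U) := by
    intro φ
    by_contra hφ
    obtain ⟨f, hf, hfU⟩ := Submodule.exists_le_ker_of_notMem hφ
    obtain ⟨p, rfl⟩ := (Module.evalEquiv ℝ P).surjective f
    have hpU : ∀ z ∈ U, p.1 z = 0 := fun z hz => hfU (Submodule.subset_span ⟨z, hz, rfl⟩)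
    obtain ⟨z, hz⟩ := hne
    have hp0 : p.1 = 0 := by
      refine (analyticOnNhd_of_mem_polySpace p.2).eq_of_eventuallyEq (z₀ := z)
        (analyticOnNhd_const (v := (0 : ℝ))) ?_
      filter_upwards [hU.mem_nhds hz] with y hy using hpU y hy
    have : p = 0 := Subtype.ext hp0
    rw [this] at hf
    simp at hf
  let b := Module.finBasis ℝ P
  have hcoord : ∀ j, ∃ l : EuclideanSpace ℝ (Fin d) →₀ ℝ, ↑l.support ⊆ U ∧
      Finsupp.linearCombination ℝ ev l = b.coord j := fun j => by
    obtain ⟨l, hl, hl'⟩ := (Finsupp.mem_span_image_iff_linearCombination ℝ).1 (hspan (b.coord j))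
    exact ⟨l, hl, hl'⟩
  choose l hlU hl using hcoord
  -- Each coordinate functional of the basis is a combination of evaluations in `U`; inserting these
  -- into the basis expansion reproduces `p`. The functions obtained need not be Lagrange functions.
  refine ⟨Finset.univ.biUnion fun j => (l j).support,
    fun ξ => ∑ j, l j ξ • (b j : EuclideanSpace ℝ (Fin d) → ℝ), fun ξ hξ => ?_, fun ξ => ?_,
    fun p hp z => ?_⟩
  · obtain ⟨j, -, hj⟩ := Finset.mem_biUnion.1 hξ
    exact hlU j hj
  · exact P.sum_mem fun j _ => P.smul_mem _ (b j).2
  · have h1 : ∀ j, b.coord j ⟨p, hp⟩ =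
        ∑ ξ ∈ Finset.univ.biUnion fun j => (l j).support, l j ξ * p ξ := fun j => by
      rw [← hl j, Finsupp.linearCombination_apply, Finsupp.sum_of_support_subset (l j)
        (Finset.subset_biUnion_of_mem (fun j => (l j).support) (Finset.mem_univ j)) _ (by simp)]
      simp [ev]
    have h2 := congrArg (fun r : P => r.1 z) (b.sum_repr ⟨p, hp⟩)
    simp only [AddSubmonoidClass.coe_finsetSum, Finset.sum_apply, Submodule.coe_smul,
      Pi.smul_apply, smul_eq_mul] at h2
    rw [← h2]
    simp only [← Module.Basis.coord_apply, h1, Finset.sum_apply, Pi.smul_apply, smul_eq_mul,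
      Finset.sum_mul]
    rw [Finset.sum_comm]
    exact Finset.sum_congr rfl fun _ _ => Finset.sum_congr rfl fun _ _ => by ring

end Polynomials

/-! ### Bounds for iterated differences of the feature map -/

section StepBounds

variable {d : ℕ}

/-- The iterated differences of `f` along `w` are bounded by the step widths. -/
def StepBounded (w : List (Fin d)) (V : Set (EuclideanSpace ℝ (Fin d))) (ρ : ℝ)
    (f : EuclideanSpace ℝ (Fin d) → ℝ) : Prop :=
  ∃ C : ℝ, ∀ y ∈ V, ∀ L : List (Fin d × ℝ), L.map Prod.fst = w → totalStep L < ρ →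
    |stepDiff L f y| ≤ C * prodStep L

/-- The iterated differences of `G` along `w` in both arguments are bounded by the squared step
widths. -/
def StepBounded₂ (w : List (Fin d)) (V : Set (EuclideanSpace ℝ (Fin d))) (ρ : ℝ)
    (G : EuclideanSpace ℝ (Fin d) → EuclideanSpace ℝ (Fin d) → ℝ) : Prop :=
  ∃ C : ℝ, ∀ y ∈ V, ∀ L : List (Fin d × ℝ), L.map Prod.fst = w → totalStep L < ρ →
    |stepDiff L (fun y' => stepDiff L (G y') y) y| ≤ C * prodStep L ^ 2

variable {w : List (Fin d)} {V U : Set (EuclideanSpace ℝ (Fin d))} {ρ : ℝ}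

theorem StepBounded.mul {f g : EuclideanSpace ℝ (Fin d) → ℝ} (hf : StepBounded w V ρ f)
    (hg : StepBounded w V ρ g) : StepBounded₂ w V ρ fun y z => f y * g z := by
  obtain ⟨C, hC⟩ := hf
  obtain ⟨C', hC'⟩ := hg
  refine ⟨C * C', fun y hy L hw hL => ?_⟩
  have h1 : ∀ y', stepDiff L (fun z => f y' * g z) y = f y' * stepDiff L g y := fun y' =>
    (map_stepDiff (AddMonoidHom.mulLeft (f y')) L g y).symm
  have h2 : stepDiff L (fun y' => f y' * stepDiff L g y) y = stepDiff L f y * stepDiff L g y :=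
    (map_stepDiff (AddMonoidHom.mulRight (stepDiff L g y)) L f y).symm
  simp only [h1, h2]
  rw [abs_mul]
  calc _ ≤ (C * prodStep L) * (C' * prodStep L) :=
        mul_le_mul (hC y hy L hw hL) (hC' y hy L hw hL) (abs_nonneg _)
          ((abs_nonneg _).trans (hC y hy L hw hL))
    _ = _ := by ring

theorem StepBounded₂.sub {G G' : EuclideanSpace ℝ (Fin d) → EuclideanSpace ℝ (Fin d) → ℝ}
    (hG : StepBounded₂ w V ρ G) (hG' : StepBounded₂ w V ρ G') :
    StepBounded₂ w V ρ fun y z => G y z - G' y z := by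
  obtain ⟨C, hC⟩ := hG
  obtain ⟨C', hC'⟩ := hG'
  refine ⟨C + C', fun y hy L hw hL => ?_⟩
  simp only [stepDiff_sub]
  rw [add_mul]
  exact (abs_sub _ _).trans (add_le_add (hC y hy L hw hL) (hC' y hy L hw hL))

theorem StepBounded₂.sum {ι : Type*} (t : Finset ι)
    {G : ι → EuclideanSpace ℝ (Fin d) → EuclideanSpace ℝ (Fin d) → ℝ}
    (hG : ∀ i ∈ t, StepBounded₂ w V ρ (G i)) :
    StepBounded₂ w V ρ fun y z => ∑ i ∈ t, G i y z := by
  choose! C hC using hG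
  refine ⟨∑ i ∈ t, C i, fun y hy L hw hL => ?_⟩
  simp only [stepDiff_sum]
  rw [Finset.sum_mul]
  exact (Finset.abs_sum_le_sum_abs _ _).trans
    (Finset.sum_le_sum fun i hi => hC i hi y hy L hw hL)

variable {x : EuclideanSpace ℝ (Fin d)} {R : ℝ} {k : ℕ}

/-- Half the radius is reserved for the base point and half for the steps, so all sampled points lie
in the ball of radius `R`; compactness bounds the derivative there. -/
theorem stepBounded_of_contDiffOn (hU : IsOpen U) (hRU : Metric.closedBall x R ⊆ U)
    {f : EuclideanSpace ℝ (Fin d) → ℝ} (hf : ContDiffOn ℝ k f U) (hw : w.length ≤ k) :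
    StepBounded w (Metric.ball x (R / 2)) (R / 2) f := by
  have hf' : ContDiffOn ℝ w.length f U := hf.of_le (by exact_mod_cast hw)
  obtain ⟨C, hC⟩ := (isCompact_closedBall x R).exists_bound_of_continuousOn
    ((continuousOn_wordDeriv hU w hf').mono hRU)
  refine ⟨C, fun y hy L hL hLR => ?_⟩
  have hlen : L.length = w.length := by rw [← hL, List.length_map]
  refine abs_stepDiff_le (x := x) (R := R) L ?_ (fun z hz => ?_) ?_
  · rw [hlen]
    exact hf'.mono (Metric.ball_subset_closedBall.trans hRU)
  · rw [hL]
    exact hC z (Metric.ball_subset_closedBall hz)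
  · linarith [Metric.mem_ball.1 hy]

/-- The one-variable estimate is used twice, once in each argument, and each use contributes a
factor `prodStep L`. In between, the difference in `y` is interchanged with the derivative in `z`.
-/
theorem stepBounded₂_of_mixedPartials (hU : IsOpen U) (hRU : Metric.closedBall x R ⊆ U)
    {K : EuclideanSpace ℝ (Fin d) → EuclideanSpace ℝ (Fin d) → ℝ}
    (h1 : ∀ y ∈ U, ContDiffOn ℝ k (fun z => K y z) U)
    (h2 : ∀ β ∈ multiIndices d k, ∀ z ∈ U,
      ContDiffOn ℝ k (fun y => multiDeriv β (fun z' => K y z') z) U)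
    (h3 : ∀ α ∈ multiIndices d k, ∀ β ∈ multiIndices d k,
      ContinuousOn (fun yz : EuclideanSpace ℝ (Fin d) × EuclideanSpace ℝ (Fin d) =>
        multiDeriv α (fun y => multiDeriv β (fun z => K y z) yz.2) yz.1) (U ×ˢ U))
    (hw : w.length ≤ k) :
    StepBounded₂ w (Metric.ball x (R / 2)) (R / 2) K := by
  have hwk : (w.length : WithTop ℕ∞) ≤ k := by exact_mod_cast hw
  have hBU : Metric.ball x R ⊆ U := Metric.ball_subset_closedBall.trans hRU
  have hα := count_mem_multiIndices hw
  set α : Fin d → ℕ := fun i => w.count i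
  obtain ⟨C, hC⟩ := ((isCompact_closedBall x R).prod
    (isCompact_closedBall x R)).exists_bound_of_continuousOn
    ((h3 α hα α hα).mono (Set.prod_mono hRU hRU))
  have hin : ∀ z ∈ U, Set.EqOn (fun y => wordDeriv w (K y) z)
      (fun y => multiDeriv α (fun z' => K y z') z) U := fun z hz y hy =>
    wordDeriv_eq_multiDeriv hU w ((h1 y hy).of_le hwk) hz
  have hinC : ∀ z ∈ U, ContDiffOn ℝ w.length (fun y => wordDeriv w (K y) z) U := fun z hz =>
    ((h2 α hα z hz).of_le hwk).congr (hin z hz)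
  have hbound : ∀ y ∈ Metric.ball x R, ∀ z ∈ Metric.ball x R,
      |wordDeriv w (fun y => wordDeriv w (K y) z) y| ≤ C := fun y hy z hz => by
    rw [wordDeriv_congr hU w (hin z (hBU hz)) (hBU hy),
      wordDeriv_eq_multiDeriv hU w ((h2 α hα z (hBU hz)).of_le hwk) (hBU hy)]
    exact hC (y, z) ⟨Metric.ball_subset_closedBall hy, Metric.ball_subset_closedBall hz⟩
  refine ⟨C, fun y hy L hL hLR => ?_⟩
  have hlen : L.length = w.length := by rw [← hL, List.length_map]
  have htot : totalStep L + dist y x < R := by linarith [Metric.mem_ball.1 hy]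
  obtain ⟨h4, h5⟩ := wordDeriv_stepDiff (f := K) hU w L (y := y) hLR fun y' hy' =>
    (h1 y' (hBU (by
      rw [Metric.mem_ball] at hy hy' ⊢
      linarith [dist_triangle y' y x]))).of_le hwk
  rw [stepDiff_comm L L K y y]
  have h6 := abs_stepDiff_le (x := x) (R := R) (C := C * prodStep L) L
    (f := fun z => stepDiff L (fun y' => K y' z) y) (by rw [hlen]; exact h4.mono hBU)
    (fun z hz => by
      rw [hL, h5 (hBU hz)]
      refine abs_stepDiff_le (x := x) (R := R) L (by rw [hlen]; exact (hinC z (hBU hz)).mono hBU)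
        (fun y' hy' => ?_) htot
      rw [hL]
      exact hbound y' hy' z hz) htot
  calc _ ≤ C * prodStep L * prodStep L := h6
    _ = C * prodStep L ^ 2 := by ring

end StepBounds

/-! ### Smoothness of the native space -/

section Smoothness

variable {d : ℕ} {K : EuclideanSpace ℝ (Fin d) → EuclideanSpace ℝ (Fin d) → ℝ}
  {P : Submodule ℝ (EuclideanSpace ℝ (Fin d) → ℝ)} {Ξ : Finset (EuclideanSpace ℝ (Fin d))}
  {ℓ : EuclideanSpace ℝ (Fin d) → EuclideanSpace ℝ (Fin d) → ℝ}

/-- Apart from `K y z`, the right side is a finite sum of products of functions of `y` and functions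
of `z`. For `Ξ ⊆ U` these factors inherit smoothness on `U` from `K` and `ℓ`. -/
theorem inner_featureVec (h : IsCPDKernel K P) (hℓ : IsReproducing P Ξ ℓ)
    (y z : EuclideanSpace ℝ (Fin d)) :
    inner ℝ (featureVec h hℓ y : NativeHilbert h) (featureVec h hℓ z : NativeHilbert h) =
      K y z - ∑ η ∈ Ξ, K y η * ℓ η z -
        ∑ ξ ∈ Ξ, ℓ ξ y * (K ξ z - ∑ η ∈ Ξ, K ξ η * ℓ η z) := by
  rw [inner_coe_eq_pairing, pairing_featureVec]
  simp only [pairing_featureVec, mul_sub, Finset.sum_sub_distrib, Finset.mul_sum]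
  have h1 : ∑ ξ ∈ Ξ, ∑ η ∈ Ξ, ℓ ξ z * (ℓ η y * K η ξ) =
      ∑ ξ ∈ Ξ, ∑ η ∈ Ξ, ℓ ξ y * (K ξ η * ℓ η z) := by
    rw [Finset.sum_comm]
    exact Finset.sum_congr rfl fun _ _ => Finset.sum_congr rfl fun _ _ => by ring
  rw [h1]
  simp only [mul_comm (K y _)]
  ring

/-- If the kernel has continuous mixed partial derivatives of order `k` near `x`, then the functions
`⟨g, Φ ·⟩` are `C^k` on a common neighbourhood of `x`, with derivatives bounded by `‖g‖`. -/
theorem exists_contDiffOn_inner_featureVec (h : IsCPDKernel K P) (hℓ : IsReproducing P Ξ ℓ)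
    {k : ℕ} (hP : ∀ p ∈ P, ContDiff ℝ k p) {U : Set (EuclideanSpace ℝ (Fin d))} (hU : IsOpen U)
    {x : EuclideanSpace ℝ (Fin d)} (hx : x ∈ U) (hΞ : ∀ ξ ∈ Ξ, ξ ∈ U)
    (h1 : ∀ y ∈ U, ContDiffOn ℝ k (fun z => K y z) U)
    (h2 : ∀ β ∈ multiIndices d k, ∀ z ∈ U,
      ContDiffOn ℝ k (fun y => multiDeriv β (fun z' => K y z') z) U)
    (h3 : ∀ α ∈ multiIndices d k, ∀ β ∈ multiIndices d k,
      ContinuousOn (fun yz : EuclideanSpace ℝ (Fin d) × EuclideanSpace ℝ (Fin d) =>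
        multiDeriv α (fun y => multiDeriv β (fun z => K y z) yz.2) yz.1) (U ×ˢ U)) :
    ∃ V, IsOpen V ∧ x ∈ V ∧
      (∀ g : NativeHilbert h,
        ContDiffOn ℝ k (fun z => inner ℝ g (featureVec h hℓ z : NativeHilbert h)) V) ∧
      ∀ w : List (Fin d), w.length ≤ k → ∃ C : ℝ, ∀ g : NativeHilbert h,
        |wordDeriv w (fun z => inner ℝ g (featureVec h hℓ z : NativeHilbert h)) x| ≤ C * ‖g‖ := by
  obtain ⟨R, hR, hRU⟩ := Metric.nhds_basis_closedBall.mem_iff.1 (hU.mem_nhds hx)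
  set V := Metric.ball x (R / 2)
  have hVU : V ⊆ U := fun y hy => hRU (by
    have := Metric.mem_ball.1 hy
    rw [Metric.mem_closedBall]; linarith)
  have hxV : x ∈ V := Metric.mem_ball_self (by linarith)
  have hℓC : ∀ ξ, ContDiffOn ℝ k (ℓ ξ) U := fun ξ => (hP _ (hℓ.mem ξ)).contDiffOn
  have hκ : ∀ y ∈ U, ContDiffOn ℝ k (fun z => K y z - ∑ η ∈ Ξ, K y η * ℓ η z) U := fun y hy =>
    (h1 y hy).sub (ContDiffOn.sum fun η _ => contDiffOn_const.mul (hℓC η))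
  have hΦ : ∀ z ∈ V, ContDiffOn ℝ k (fun y => inner ℝ (featureVec h hℓ z : NativeHilbert h)
      (featureVec h hℓ y : NativeHilbert h)) V := by
    intro z hz
    simp only [inner_featureVec]
    exact ((hκ z (hVU hz)).sub (ContDiffOn.sum fun ξ hξ =>
      contDiffOn_const.mul (hκ ξ (hΞ ξ hξ)))).mono hVU
  have hC : ∀ w : List (Fin d), w.length ≤ k → ∃ C : ℝ, ∃ ε > 0, ∀ y ∈ V,
      ∀ L : List (Fin d × ℝ), L.map Prod.fst = w → totalStep L < ε →
      ‖stepDiff L (fun z => (featureVec h hℓ z : NativeHilbert h)) y‖ ≤ C * prodStep L := by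
    intro w hw
    have hb : ∀ f : EuclideanSpace ℝ (Fin d) → ℝ, ContDiffOn ℝ k f U →
        StepBounded w V (R / 2) f := fun f hf => stepBounded_of_contDiffOn hU hRU hf hw
    have hsymm : ∀ η ∈ Ξ, ContDiffOn ℝ k (fun y => K y η) U := fun η hη => by
      simpa only [h.symm η] using h1 η (hΞ η hη)
    have hG : StepBounded₂ w V (R / 2) fun y z =>
        inner ℝ (featureVec h hℓ y : NativeHilbert h) (featureVec h hℓ z : NativeHilbert h) := by
      simp only [inner_featureVec]
      refine ((stepBounded₂_of_mixedPartials hU hRU h1 h2 h3 hw).sub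
        (StepBounded₂.sum Ξ fun η hη => ?_)).sub (StepBounded₂.sum Ξ fun ξ hξ => ?_)
      · exact (hb _ (hsymm η hη)).mul (hb _ (hℓC η))
      · exact (hb _ (hℓC ξ)).mul (hb _ (hκ ξ (hΞ ξ hξ)))
    obtain ⟨C, hC⟩ := hG
    refine ⟨√|C|, R / 2, by linarith, fun y hy L hL hLR => ?_⟩
    set Φ : EuclideanSpace ℝ (Fin d) → NativeHilbert h :=
      fun z => (featureVec h hℓ z : NativeHilbert h)
    have hinner : ∀ (v : NativeHilbert h), stepDiff L (fun z => inner ℝ v (Φ z)) y =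
        inner ℝ v (stepDiff L Φ y) := fun v =>
      (map_stepDiff (innerSL ℝ v : NativeHilbert h →L[ℝ] ℝ).toLinearMap.toAddMonoidHom L Φ y).symm
    have h4 := hC y hy L hL hLR
    -- Taking the same steps in both arguments yields a squared norm, which is why the constant for
    -- `Φ` is a square root.
    have h5 : stepDiff L (fun y' => stepDiff L (fun z => inner ℝ (Φ y') (Φ z)) y) y =
        ‖stepDiff L Φ y‖ ^ 2 := by
      simp only [hinner]
      simp only [fun y' => real_inner_comm (stepDiff L Φ y) (Φ y')]
      rw [hinner, real_inner_self_eq_norm_sq]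
    rw [h5] at h4
    refine abs_le_of_sq_le_sq' ?_ (mul_nonneg (Real.sqrt_nonneg _) (prodStep_nonneg L)) |>.2
    rw [mul_pow, Real.sq_sqrt (abs_nonneg C)]
    calc _ ≤ _ := le_abs_self _
      _ ≤ _ := h4
      _ ≤ _ := by gcongr; exact le_abs_self C
  have hsm := contDiffOn_inner_of_stepDiff_le Metric.isOpen_ball k _ hΦ hC
  refine ⟨V, Metric.isOpen_ball, hxV, hsm, fun w hw => ?_⟩
  obtain ⟨C, ε, hε, hC⟩ := hC w hw
  exact ⟨C, fun g => abs_wordDeriv_inner_le Metric.isOpen_ball _ w hε hxV (hC x hxV) g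
    ((hsm g).of_le (by exact_mod_cast hw))⟩

end Smoothness

/-! ### Differential operators -/

section DiffOp

variable {d k : ℕ} {a : (Fin d → ℕ) → EuclideanSpace ℝ (Fin d) → ℝ} {x : EuclideanSpace ℝ (Fin d)}

theorem diffOp_zero_apply (f : EuclideanSpace ℝ (Fin d) → ℝ) :
    diffOp 0 a f x = (∑ α ∈ multiIndices d 0, a α x) * f x := by
  rw [diffOp, Finset.sum_mul]
  refine Finset.sum_congr rfl fun α hα => ?_
  have : multiWord α = [] := List.length_eq_zero_iff.1 (Nat.le_zero.1 (length_multiWord_le hα))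
  rw [multiDeriv_eq_wordDeriv, this, wordDeriv]

/-- The functions that are `C^k` at `x`. -/
def smoothAt (k : ℕ) (x : EuclideanSpace ℝ (Fin d)) :
    Submodule ℝ (EuclideanSpace ℝ (Fin d) → ℝ) where
  carrier := {f | ContDiffAt ℝ k f x}
  zero_mem' := show ContDiffAt ℝ k (fun _ => (0 : ℝ)) x from contDiffAt_const
  add_mem' := fun {_ _} (hf : ContDiffAt ℝ k _ x) (hg : ContDiffAt ℝ k _ x) => hf.add hg
  smul_mem' := fun r _ (hf : ContDiffAt ℝ k _ x) => hf.const_smul r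

theorem exists_isOpen_contDiffOn {f : EuclideanSpace ℝ (Fin d) → ℝ} (hf : ContDiffAt ℝ k f x) :
    ∃ U, IsOpen U ∧ x ∈ U ∧ ContDiffOn ℝ k f U := by
  obtain ⟨u, hu, hfu⟩ := hf.contDiffOn le_rfl (by simp)
  obtain ⟨U, hUu, hU, hxU⟩ := mem_nhds_iff.1 hu
  exact ⟨U, hU, hxU, hfu.mono hUu⟩

theorem diffOp_add {f g : EuclideanSpace ℝ (Fin d) → ℝ} (hf : ContDiffAt ℝ k f x)
    (hg : ContDiffAt ℝ k g x) : diffOp k a (f + g) x = diffOp k a f x + diffOp k a g x := by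
  obtain ⟨U, hU, hxU, hfU⟩ := exists_isOpen_contDiffOn hf
  obtain ⟨U', hU', hxU', hgU'⟩ := exists_isOpen_contDiffOn hg
  simp only [diffOp, ← Finset.sum_add_distrib, ← mul_add, multiDeriv_eq_wordDeriv]
  refine Finset.sum_congr rfl fun α hα => ?_
  have hk : ((multiWord α).length : WithTop ℕ∞) ≤ k := by
    exact_mod_cast length_multiWord_le hα
  rw [wordDeriv_add (hU.inter hU') _ ((hfU.mono Set.inter_subset_left).of_le hk)
    ((hgU'.mono Set.inter_subset_right).of_le hk) ⟨hxU, hxU'⟩, Pi.add_apply]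

theorem diffOp_smul (r : ℝ) {f : EuclideanSpace ℝ (Fin d) → ℝ} (hf : ContDiffAt ℝ k f x) :
    diffOp k a (r • f) x = r * diffOp k a f x := by
  obtain ⟨U, hU, hxU, hfU⟩ := exists_isOpen_contDiffOn hf
  simp only [diffOp, Finset.mul_sum, multiDeriv_eq_wordDeriv]
  refine Finset.sum_congr rfl fun α hα => ?_
  have hk : ((multiWord α).length : WithTop ℕ∞) ≤ k := by
    exact_mod_cast length_multiWord_le hα
  rw [wordDeriv_smul hU _ r (hfU.of_le hk) hxU, Pi.smul_apply, smul_eq_mul]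
  ring

variable {q : ℕ} {K : EuclideanSpace ℝ (Fin d) → EuclideanSpace ℝ (Fin d) → ℝ}

/-- An operator of order zero is a multiple of evaluation at `x`: it is linear on all functions,
whence `S = ⊤`, and bounded by Cauchy–Schwarz against `featureVec h hℓ x`. -/
theorem exists_isRecoverable_zero (h : IsCPDKernel K (polySpace d q)) :
    ∃ Ξ ℓ, ∃ hℓ : IsReproducing (polySpace d q) Ξ ℓ,
      IsRecoverable h hℓ ⊤ fun f => diffOp 0 a f x := by
  obtain ⟨Ξ, ℓ, -, hℓ⟩ := exists_isReproducing_polySpace d q isOpen_univ Set.univ_nonempty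
  refine ⟨Ξ, ℓ, hℓ, ?_, ?_, le_top, fun _ => Submodule.mem_top, ?_⟩
  · intro f _ g _
    simp only [diffOp_zero_apply, Pi.add_apply, mul_add]
  · intro r f _
    simp only [diffOp_zero_apply, Pi.smul_apply, smul_eq_mul]
    ring
  · refine ⟨|∑ α ∈ multiIndices d 0, a α x| * ‖(featureVec h hℓ x : NativeHilbert h)‖,
      fun g => ?_⟩
    rw [diffOp_zero_apply, abs_mul, mul_assoc, mul_comm ‖(_ : NativeHilbert h)‖]
    gcongr
    exact abs_real_inner_le_norm _ _

theorem exists_isRecoverable (h : IsCPDKernel K (polySpace d q)) (hK : HasMixedPartialsNear k K x) :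
    ∃ Ξ ℓ, ∃ hℓ : IsReproducing (polySpace d q) Ξ ℓ,
      IsRecoverable h hℓ (smoothAt k x) fun f => diffOp k a f x := by
  obtain ⟨U, hU, hxU, h1, h2, h3⟩ := hK
  obtain ⟨Ξ, ℓ, hΞ, hℓ⟩ := exists_isReproducing_polySpace d q hU ⟨x, hxU⟩
  obtain ⟨V, hV, hxV, hsm, hbd⟩ := exists_contDiffOn_inner_featureVec h hℓ
    (fun p hp => contDiff_of_mem_polySpace hp) hU hxU hΞ h1 h2 h3
  have hnat : nativeSpace h ≤ smoothAt k x := by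
    rintro f ⟨g, hg⟩
    have hf : f = (fun z => inner ℝ g (featureVec h hℓ z : NativeHilbert h)) +
      fun z => ∑ ξ ∈ Ξ, ℓ ξ z * f ξ := funext fun z => hg.apply_eq hℓ z
    rw [hf]
    exact ((hsm g).contDiffAt (hV.mem_nhds hxV)).add
      (contDiff_of_mem_polySpace (hℓ.sum_mem f)).contDiffAt
  refine ⟨Ξ, ℓ, hℓ, fun f hf g hg => diffOp_add hf hg, fun r f hf => diffOp_smul r hf, hnat,
    fun y => ?_, ?_⟩
  -- The point `y` may lie outside `U`. Still, `K(·, y)` is a native function plus a combination of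
  -- the `K ξ ·` with `ξ ∈ Ξ ⊆ U`, which are smooth at `x` by hypothesis.
  · have h4 := represents_coe h (featureVec h hℓ y)
    have h5 : (fun z => K z y) = (fun z => pairing ((featureVec h hℓ y).coeff h) fun y => K y z) +
        ∑ ξ ∈ Ξ, ℓ ξ y • fun z => K ξ z := by
      funext z
      simp [pairing_featureVec, Finset.sum_apply, h.symm z y]
    rw [h5]
    refine Submodule.add_mem _ (hnat ⟨_, h4⟩) (Submodule.sum_mem _ fun ξ hξ =>
      Submodule.smul_mem _ _ ?_)
    exact (h1 ξ (hΞ ξ hξ)).contDiffAt (hU.mem_nhds hxU)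
  · choose! C hC using hbd
    refine ⟨∑ α ∈ multiIndices d k, |a α x| * C (multiWord α), fun g => ?_⟩
    rw [Finset.sum_mul]
    simp only [diffOp, multiDeriv_eq_wordDeriv]
    refine (Finset.abs_sum_le_sum_abs _ _).trans (Finset.sum_le_sum fun α hα => ?_)
    rw [abs_mul, mul_assoc]
    gcongr
    exact hC _ (length_multiWord_le hα) g

/-- Finiteness and formula of the worst case error, existence and uniqueness of the kernel-based
weights, and their optimality. -/
theorem IsRecoverable.optimalRecovery {Ω : Type*} {K : Ω → Ω → ℝ} {P : Submodule ℝ (Ω → ℝ)}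
    {Ξ : Finset Ω} {ℓ : Ω → Ω → ℝ} {h : IsCPDKernel K P} {hℓ : IsReproducing P Ξ ℓ}
    {S : Submodule ℝ (Ω → ℝ)} {lam : (Ω → ℝ) → ℝ} (hl : IsRecoverable h hℓ S lam) {n : ℕ}
    (X : Fin n → Ω) (hX : Function.Injective X) :
    (∀ u : Fin n → ℝ, IsExact P lam X u →
      worstCaseError h lam X u ≠ ⊤ ∧
      (worstCaseError h lam X u).toReal ^ 2 =
        lam (fun y => lam (fun z => K y z))
          - ∑ i, u i * (lam (fun y => K y (X i)) + lam (fun z => K (X i) z))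
          + ∑ i, ∑ j, u i * u j * K (X i) (X j)) ∧
    ((∃ u : Fin n → ℝ, IsExact P lam X u) → ∃! w : Fin n → ℝ, IsKernelWeights K P lam X w) ∧
    (∀ w : Fin n → ℝ, IsKernelWeights K P lam X w →
      IsLeast ((fun u => worstCaseError h lam X u) '' {u | IsExact P lam X u})
        (worstCaseError h lam X w)) := by
  refine ⟨fun u hu => ?_, hl.existsUnique_isKernelWeights hX,
    fun w hw => hl.isLeast_worstCaseError hw⟩
  obtain ⟨v, hv⟩ := hl.exists_errorVec X u hu
  rw [worstCaseError_eq hℓ hv, ENNReal.toReal_ofReal (norm_nonneg _)]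
  exact ⟨ENNReal.ofReal_ne_top, hl.norm_sq_errorVec hv⟩

end DiffOp

end OptRec

end

theorem mainTheorem5 (d q k n : ℕ)
    (K : EuclideanSpace ℝ (Fin d) → EuclideanSpace ℝ (Fin d) → ℝ)
    (hK : OptRec.IsCPDKernel K (OptRec.polySpace d q))
    (a : (Fin d → ℕ) → EuclideanSpace ℝ (Fin d) → ℝ)
    (x : EuclideanSpace ℝ (Fin d))
    (hsmooth : k ≠ 0 → OptRec.HasMixedPartialsNear k K x)
    (X : Fin n → EuclideanSpace ℝ (Fin d)) (hX : Function.Injective X)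
    (lam : (EuclideanSpace ℝ (Fin d) → ℝ) → ℝ)
    (hlam : lam = fun f => OptRec.diffOp k a f x)
    (E : (Fin n → ℝ) → ENNReal)
    (hE : E = fun u => OptRec.worstCaseError hK lam X u) :
    -- all derivatives that occur below exist
    (k ≠ 0 → ∀ f ∈ OptRec.nativeSpace hK, ContDiffAt ℝ k f x) ∧
    (k ≠ 0 → ∀ y, ContDiffAt ℝ k (fun z => K z y) x ∧ ContDiffAt ℝ k (fun z => K y z) x) ∧
    -- the worst case error is finite and given by the quadratic formula
    (∀ u : Fin n → ℝ, OptRec.IsExact (OptRec.polySpace d q) lam X u →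
      E u ≠ ⊤ ∧
      (E u).toReal ^ 2 =
        lam (fun y => lam (fun z => K y z))
          - ∑ i, u i * (lam (fun y => K y (X i)) + lam (fun z => K (X i) z))
          + ∑ i, ∑ j, u i * u j * K (X i) (X j)) ∧
    -- the kernel-based weights exist and are unique as soon as some exact formula exists
    ((∃ u : Fin n → ℝ, OptRec.IsExact (OptRec.polySpace d q) lam X u) →
      ∃! w : Fin n → ℝ, OptRec.IsKernelWeights K (OptRec.polySpace d q) lam X w) ∧
    -- and they minimize the worst case error among all exact formulas
    (∀ w : Fin n → ℝ, OptRec.IsKernelWeights K (OptRec.polySpace d q) lam X w →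
      IsLeast (E '' {u | OptRec.IsExact (OptRec.polySpace d q) lam X u}) (E w)) := by
  subst hlam hE
  -- For `k = 0` nothing is assumed about the regularity of `K`, so the functional is handled on all
  -- functions; for `k ≥ 1` it is handled on those that are `C^k` at `x`.
  rcases eq_or_ne k 0 with rfl | hk
  · obtain ⟨Ξ, ℓ, hℓ, hl⟩ := OptRec.exists_isRecoverable_zero (a := a) (x := x) hK
    exact ⟨fun h => absurd rfl h, fun h => absurd rfl h, hl.optimalRecovery X hX⟩
  · obtain ⟨Ξ, ℓ, hℓ, hl⟩ := OptRec.exists_isRecoverable (a := a) hK (hsmooth hk)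
    exact ⟨fun _ f hf => hl.native_le hf, fun _ y => ⟨hl.kernel_mem y, hl.kernel_mem' y⟩,
      hl.optimalRecovery X hX⟩
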